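/- Let $\mathbb F_q$ be the finite field with $q$ elements, let $m$ and $\alpha_1$ be integers with $2\le\alpha_1\le m-1$, let $V$ be an $m$-dimensional vector space over $\mathbb F_q$ with a fixed ordered basis, and let $A_1\subset A_2=V$ be subspaces with $\dim A_1=\alpha_1$. Put $\alpha=(\alpha_1,m)$ and let $$\Omega_\alpha(2,m)=\{P\subseteq V \text{ a subspace}:\ \dim P=2,\ \dim(P\cap A_1)\ge 1\}.$$ For every two-dimensional subspace $P$ of $V$ let $M_P$ be a $2\times m$ matrix whose rows are the coordinate vectors of a chosen basis of $P$. The Schubert code $C_\alpha(2,m)$ is the linear code consisting of all words $(f(M_P))_{P\in\Omega_\alpha(2,m)}$, where $f$ ranges over the $\mathbb F_q$-linear combinations of the $2\times 2$ minors of a generic $2\times m$ matrix; its coordinates are indexed by $\Omega_\alpha(2,m)$. A parity check of a linear code $C$ is a word $\omega$ with $\omega\cdot c=0$ for all $c\in C$. A set $\mathcal J$ of parity checks of $C$ is orthogonal on the coordinate $i$ if $\omega_i=1$ for every $\omega\in\mathcal J$ and, for every coordinate $j\ne i$, at most one $\omega\in\mathcal J$ has $\omega_j\ne 0$. Write ${n\brack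 1}_q=\frac{q^n-1}{q-1}$ and $$J=\frac{\lfloor q/2\rfloor^2}{q-1}\left(\left(q^{m-2}+(q-1)q^{\alpha_1-1}\right){\alpha_1-1\brack 1}_q-q^2\,\frac{q^{2\alpha_1-2}-1}{q^2-1}\right)+\lfloor q/2\rfloor\left(q{\alpha_1-1\brack 1}_q+{m-2\brack 1}_q\right).$$ Then for every coordinate $P\in\Omega_\alpha(2,m)$ there is a set of exactly $J$ parity checks of $C_\alpha(2,m)$ that is orthogonal on $P$. Moreover, for every choice, for each coordinate $P$, of such a set $\mathcal J(P)$ of $J$ parity checks orthogonal on $P$, the corresponding majority logic decoder corrects up to $\lfloor J/2\rfloor$ errors: if $c\in C_\alpha(2,m)$ and $y$ differs from $c$ in at most $\lfloor J/2\rfloor$ coordinates, then the decoder maps $y$ to $c$. Here the decoder replaces each $y_P$ by $y_P-\hat e_P$, where $\hat e_P$ is the value taken most often among the $\omega\cdot y$, $\omega\in\mathcal J(P)$, with $\hat e_P=0$ if $0$ is one of the most frequent values and ties between non-zero values broken arbitrarily. -/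

import Mathlib

section LinearCodes

variable {F ι : Type*} [Field F] [Fintype F] [DecidableEq F] [Fintype ι]

/-- The dual of a linear code; its elements are the parity checks of the code. -/
def dualCode (C : Submodule F (ι → F)) : Submodule F (ι → F) where
  carrier := {w | ∀ c ∈ C, w ⬝ᵥ c = 0}
  add_mem' := fun {v w} hv hw c hc => by rw [add_dotProduct, hv c hc, hw c hc, add_zero]
  zero_mem' := fun c _ => zero_dotProduct c
  smul_mem' := fun r w hw c hc => by rw [smul_dotProduct, hw c hc, smul_zero]

/-- A set `𝒥` of parity checks of `C` is orthogonal on the coordinate `i` if all its members have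
`i`-th entry `1` and, for every other coordinate `j`, at most one of them is non-zero at `j`. -/
structure IsOrthogonalOn (C : Submodule F (ι → F)) (𝒥 : Finset (ι → F)) (i : ι) : Prop where
  parityCheck : ∀ w ∈ 𝒥, w ∈ dualCode C
  eq_one : ∀ w ∈ 𝒥, w i = 1
  column_weight : ∀ j, j ≠ i → (𝒥.filter fun w => w j ≠ 0).card ≤ 1

/-- The number of checks in `𝒥` that take the value `v` on the received word `y`. -/
def voteCount (𝒥 : Finset (ι → F)) (y : ι → F) (v : F) : ℕ :=
  (𝒥.filter fun w => w ⬝ᵥ y = v).card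

/-- `v` is one of the values taken most often by the checks in `𝒥` on the received word `y`. -/
def IsMostFrequent (𝒥 : Finset (ι → F)) (y : ι → F) (v : F) : Prop :=
  ∀ u, voteCount 𝒥 y u ≤ voteCount 𝒥 y v

theorem exists_isMostFrequent (𝒥 : Finset (ι → F)) (y : ι → F) :
    ∃ v, IsMostFrequent 𝒥 y v := by
  obtain ⟨v, -, hv⟩ := Finset.exists_max_image Finset.univ (voteCount 𝒥 y) ⟨0, Finset.mem_univ 0⟩
  exact ⟨v, fun u => hv u (Finset.mem_univ u)⟩

open Classical in
/-- The majority vote for the error value: the value taken most often by the checks in `𝒥`;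
a tie in which `0` takes part is decided in favour of `0`. -/
noncomputable def majorityVote (𝒥 : Finset (ι → F)) (y : ι → F) : F :=
  if IsMostFrequent 𝒥 y 0 then 0 else (exists_isMostFrequent 𝒥 y).choose

/-- The (one step) majority logic decoder given by a set `𝒥 i` of checks for every coordinate `i`:
it subtracts from each received symbol the error value voted for by the checks in `𝒥 i`. -/
noncomputable def majorityLogicDecode (𝒥 : ι → Finset (ι → F)) (y : ι → F) : ι → F :=
  fun i => y i - majorityVote (𝒥 i) y

/-- The decoder `D` corrects up to `t` errors for the code `C`. -/
def CorrectsErrors (C : Submodule F (ι → F)) (D : (ι → F) → (ι → F)) (t : ℕ) : Prop :=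
  ∀ c ∈ C, ∀ y : ι → F, hammingDist y c ≤ t → D y = c

end LinearCodes

section SchubertCodes

open Module

variable {F V : Type*} [Field F] [AddCommGroup V] [Module F V] {ℓ m : ℕ}

variable (F V ℓ) in
/-- The Grassmannian of `ℓ`-dimensional subspaces of `V`. -/
def grassmannian : Set (Submodule F V) := {P | finrank F P = ℓ}

/-- `A` is a partial flag of dimension sequence `α`. -/
def IsPartialFlag (A : Fin ℓ → Submodule F V) (α : Fin ℓ → ℕ) : Prop :=
  Monotone A ∧ ∀ i, finrank F (A i) = α i

/-- The Schubert variety `{P : dim P = ℓ, dim (P ∩ A_i) ≥ i for 1 ≤ i ≤ ℓ}` of a partial flag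
(the index `i : Fin ℓ` starts at `0`). -/
def schubertVariety (A : Fin ℓ → Submodule F V) : Set (Submodule F V) :=
  {P | P ∈ grassmannian F V ℓ ∧ ∀ i : Fin ℓ, (i : ℕ) + 1 ≤ finrank F ↥(P ⊓ A i)}

noncomputable instance schubertVarietyFintype [Finite V] (A : Fin ℓ → Submodule F V) :
    Fintype (schubertVariety A) := Fintype.ofFinite _

variable (F ℓ m) in
/-- The space of linear forms in the maximal minors of a generic `ℓ × m` matrix. -/
noncomputable def minorForms : Submodule F (MvPolynomial (Fin ℓ × Fin m) F) :=
  Submodule.span F (Set.range fun β : Fin ℓ ↪o Fin m =>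
    ((Matrix.mvPolynomialX (Fin ℓ) (Fin m) F).submatrix id β).det)

/-- The matrix `M_P` whose rows are the coordinates, in the basis `b` of `V`, of the chosen
basis `u P` of `P`. -/
noncomputable def planeMatrix (b : Basis (Fin m) F V)
    (u : ∀ P : grassmannian F V ℓ, Basis (Fin ℓ) F P.1) (P : grassmannian F V ℓ) :
    Matrix (Fin ℓ) (Fin m) F :=
  Matrix.of fun i j => b.repr (u P i : V) j

/-- Evaluation of polynomials in the entries of an `ℓ × m` matrix at the matrices `M_P`. -/
noncomputable def evalMap (b : Basis (Fin m) F V)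
    (u : ∀ P : grassmannian F V ℓ, Basis (Fin ℓ) F P.1) :
    MvPolynomial (Fin ℓ × Fin m) F →ₗ[F] (grassmannian F V ℓ → F) :=
  LinearMap.pi fun P =>
    (MvPolynomial.aeval fun x : Fin ℓ × Fin m => planeMatrix b u P x.1 x.2).toLinearMap

/-- The Grassmann code. -/
noncomputable def grassmannCode (b : Basis (Fin m) F V)
    (u : ∀ P : grassmannian F V ℓ, Basis (Fin ℓ) F P.1) :
    Submodule F (grassmannian F V ℓ → F) :=
  (minorForms F ℓ m).map (evalMap b u)

/-- The Schubert code: the Grassmann code punctured outside the Schubert variety. -/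
noncomputable def schubertCode (b : Basis (Fin m) F V)
    (u : ∀ P : grassmannian F V ℓ, Basis (Fin ℓ) F P.1) (A : Fin ℓ → Submodule F V) :
    Submodule F (schubertVariety A → F) :=
  (grassmannCode b u).map
    (LinearMap.funLeft F F fun P : schubertVariety A => (⟨P.1, P.2.1⟩ : grassmannian F V ℓ))

end SchubertCodes

/-- The Gaussian binomial coefficient `[n choose k]_q`. -/
def gaussBinom (q n k : ℕ) : ℚ :=
  (∏ i ∈ Finset.range k, ((q : ℚ) ^ n - (q : ℚ) ^ i)) /
    ∏ i ∈ Finset.range k, ((q : ℚ) ^ k - (q : ℚ) ^ i)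

/-- The number `J` of parity checks orthogonal on each coordinate of the Schubert code
`C_{(a, m)}(2, m)` over the field with `q` elements. Here `q / 2` is a natural number, the integer
part of one half of `q`. -/
def schubertJ (q m a : ℕ) : ℚ :=
  ((q / 2 : ℕ) : ℚ) ^ 2 / ((q : ℚ) - 1) *
      (((q : ℚ) ^ (m - 2) + ((q : ℚ) - 1) * (q : ℚ) ^ (a - 1)) * gaussBinom q (a - 1) 1
        - (q : ℚ) ^ 2 * (((q : ℚ) ^ (2 * a - 2) - 1) / ((q : ℚ) ^ 2 - 1)))
    + ((q / 2 : ℕ) : ℚ) * ((q : ℚ) * gaussBinom q (a - 1) 1 + gaussBinom q (m - 2) 1)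

/-! A codeword is the value of an alternating bilinear form φ on the chosen bases of the planes. A
relation φ p = ∑ r φ(v), valid for all φ, between a basis p of P and bases v of other planes of the
Schubert variety is therefore a parity check, and relations that share no plane other than P are
orthogonal on P (`exists_isOrthogonalOn_of_relations`).

Fix a basis e₁, e₂ of P with e₁ in A₁, a complement B of P ∩ A₁ in A₁, and a complement K of P
containing B. Two kinds of relations are used. Lines: the planes ⟨d, w + t d'⟩, with d, d' a basis
of P, w in K and t in F, are the points other than P of a line through P, and φ is affine in t. A
difference at two parameters gives a check of weight 3, so a line yields ⌊q/2⌋ checks with disjoint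
supports outside P. Grids: for a basis x, y of a plane of K, the planes ⟨x + νe₂ + se₁, y + μe₁ +
te₂⟩ meet P trivially, and the mixed second difference of φ in s and t is a multiple of φ(e₁, e₂).
Pairing the values of s and of t gives ⌊q/2⌋² checks of weight 5 for each grid. Projection along P
sends line points to dimension 1 and grid points to dimension 2, and recovers the line or plane of K
used. Hence no plane is used twice, and the two families can be united (`PlaneFrame.exists_checks`).

If P is not contained in A₁, the lines and grids inside the Schubert variety yield exactly J checks
(`schubertJ_eq`). If P ≤ A₁, they yield at least J (`schubertJ_le`), and a subset suffices. The
decoding claim holds for any orthogonal checks: each error outside the decoded coordinate spoils at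
most one vote. -/

/-! ### Majority logic decoding with orthogonal checks. -/

theorem voteCount_add_voteCount_le {F ι : Type*} [Field F] [Fintype F] [DecidableEq F] [Fintype ι]
    (𝒥 : Finset (ι → F)) (y : ι → F) {u v : F} (h : u ≠ v) :
    voteCount 𝒥 y u + voteCount 𝒥 y v ≤ 𝒥.card := by
  classical
  unfold voteCount
  rw [← Finset.card_union_of_disjoint]
  · exact Finset.card_le_card (Finset.union_subset (Finset.filter_subset _ _)
      (Finset.filter_subset _ _))
  · rw [Finset.disjoint_filter]
    rintro w - h1 h2
    exact h (h1.symm.trans h2)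

/-- Half of the votes suffice for the value 0 because ties are decided in its favour; any other
value needs a strict majority. -/
theorem majorityVote_eq_of_card_le {F ι : Type*} [Field F] [Fintype F] [DecidableEq F] [Fintype ι]
    (𝒥 : Finset (ι → F)) (y : ι → F) (e : F)
    (h0 : e = 0 → 𝒥.card ≤ 2 * voteCount 𝒥 y e)
    (h1 : e ≠ 0 → 𝒥.card < 2 * voteCount 𝒥 y e) : majorityVote 𝒥 y = e := by
  unfold majorityVote
  by_cases he : e = 0
  · subst he
    rw [if_pos]
    intro u
    by_cases hu : u = 0
    · rw [hu]
    · have := voteCount_add_voteCount_le 𝒥 y hu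
      have := h0 rfl
      omega
  · have key : ∀ v, IsMostFrequent 𝒥 y v → v = e := by
      intro v hv
      by_contra hne
      have h2 := voteCount_add_voteCount_le 𝒥 y hne
      have h3 := hv e
      have := h1 he
      omega
    split_ifs with h
    · exact key 0 h
    · exact key _ (exists_isMostFrequent 𝒥 y).choose_spec

/-- The checks orthogonal on `i` whose value on `y` is not the error at `i` are at most as many as
the erroneous positions other than `i`. -/
theorem IsOrthogonalOn.card_wrong_le {F ι : Type*} [Field F] [Fintype F] [DecidableEq F] [Fintype ι]
    [DecidableEq ι] {C : Submodule F (ι → F)} {𝒥 : Finset (ι → F)} {i : ι}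
    (h : IsOrthogonalOn C 𝒥 i) {c y : ι → F} (hc : c ∈ C) :
    (𝒥.filter fun w => w ⬝ᵥ y ≠ y i - c i).card ≤
      ((Finset.univ.filter fun j => y j ≠ c j).erase i).card := by
  -- A check vanishes on `c`, so it sees only `y - c`. If it misses every error outside `i`, its
  -- value is the error at `i`.
  have hsub : (𝒥.filter fun w => w ⬝ᵥ y ≠ y i - c i) ⊆
      ((Finset.univ.filter fun j => y j ≠ c j).erase i).biUnion
        fun j => 𝒥.filter fun w => w j ≠ 0 := by
    intro w hw
    obtain ⟨hw, hne⟩ := Finset.mem_filter.1 hw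
    by_contra hcon
    apply hne
    have hz : ∀ j, j ≠ i → w j * (y j - c j) = 0 := by
      intro j hj
      by_contra hmul
      apply hcon
      rw [Finset.mem_biUnion]
      refine ⟨j, ?_, Finset.mem_filter.2 ⟨hw, left_ne_zero_of_mul hmul⟩⟩
      simp only [Finset.mem_erase, Finset.mem_filter, Finset.mem_univ, true_and]
      exact ⟨hj, sub_ne_zero.1 (right_ne_zero_of_mul hmul)⟩
    have h1 : w ⬝ᵥ y = w ⬝ᵥ (y - c) := by
      rw [dotProduct_sub, h.parityCheck w hw c hc, sub_zero]
    rw [h1, dotProduct, Finset.sum_eq_single i]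
    · simp [h.eq_one w hw]
    · exact fun j _ hj => hz j hj
    · simp
  refine (Finset.card_le_card hsub).trans ?_
  refine (Finset.card_biUnion_le_card_mul _ _ 1 fun j hj => ?_).trans (mul_one _).le
  exact h.column_weight j (Finset.ne_of_mem_erase hj)

/-- One step majority logic decoding with `J` orthogonal checks for every coordinate corrects up to
`J / 2` errors. -/
theorem correctsErrors_majorityLogicDecode {F ι : Type*} [Field F] [Fintype F] [DecidableEq F]
    [Fintype ι] {C : Submodule F (ι → F)} {𝒥 : ι → Finset (ι → F)} {J : ℕ}
    (h : ∀ i, (𝒥 i).card = J ∧ IsOrthogonalOn C (𝒥 i) i) :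
    CorrectsErrors C (majorityLogicDecode 𝒥) (J / 2) := by
  classical
  intro c hc y hy
  funext i
  obtain ⟨hJ, ho⟩ := h i
  have hw := ho.card_wrong_le (y := y) hc
  have hsplit : voteCount (𝒥 i) y (y i - c i) +
      ((𝒥 i).filter fun w => w ⬝ᵥ y ≠ y i - c i).card = (𝒥 i).card :=
    Finset.card_filter_add_card_filter_not _
  have hy' : (Finset.univ.filter fun j => y j ≠ c j).card ≤ J / 2 := hy
  have : majorityVote (𝒥 i) y = y i - c i := by
    apply majorityVote_eq_of_card_le
    · intro _
      have := Finset.card_le_card (Finset.erase_subset i (Finset.univ.filter fun j => y j ≠ c j))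
      omega
    -- Here `i` is itself an error, so at most `J / 2 - 1` others remain to spoil votes; this gives
    -- the strict majority.
    · intro he
      have hmem : i ∈ Finset.univ.filter fun j => y j ≠ c j := by
        simpa using sub_ne_zero.1 he
      have := Finset.card_erase_lt_of_mem hmem
      omega
  unfold majorityLogicDecode
  rw [this, sub_sub_cancel]

/-! ### From relations between alternating forms to parity checks. -/

section PluckerWords

open Module

variable {F V : Type*} [Field F] [AddCommGroup V] [Module F V] {ℓ m : ℕ}

/-- Every linear form in the maximal minors is given on the matrices `M_P` by an alternating
form. -/
theorem exists_alternatingMap_of_mem_minorForms (b : Basis (Fin m) F V)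
    (u : ∀ P : grassmannian F V ℓ, Basis (Fin ℓ) F P.1)
    {f : MvPolynomial (Fin ℓ × Fin m) F} (hf : f ∈ minorForms F ℓ m) :
    ∃ φ : V [⋀^Fin ℓ]→ₗ[F] F, ∀ P, evalMap b u f P = φ fun i => (u P i : V) := by
  induction hf using Submodule.span_induction with
  | mem f hf =>
    obtain ⟨β, rfl⟩ := hf
    -- A minor is the determinant composed with the projection to the coordinates selected by `β`.
    refine ⟨Matrix.detRowAlternating.compLinearMap
      ((LinearMap.funLeft F F β).comp b.equivFun.toLinearMap), fun P => ?_⟩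
    simp only [evalMap, LinearMap.pi_apply, AlgHom.toLinearMap_apply, AlgHom.map_det]
    rw [AlternatingMap.compLinearMap_apply]
    change Matrix.det _ = Matrix.det _
    congr 1
    ext i j
    simp [planeMatrix, LinearMap.funLeft_apply]
  | zero => exact ⟨0, fun P => by simp⟩
  | add f g _ _ hf hg =>
    obtain ⟨φ, hφ⟩ := hf
    obtain ⟨ψ, hψ⟩ := hg
    exact ⟨φ + ψ, fun P => by simp [hφ, hψ]⟩
  | smul r f _ hf =>
    obtain ⟨φ, hφ⟩ := hf
    exact ⟨r • φ, fun P => by simp [hφ]⟩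

theorem exists_alternatingMap_of_mem_schubertCode (b : Basis (Fin m) F V)
    (u : ∀ P : grassmannian F V ℓ, Basis (Fin ℓ) F P.1) (A : Fin ℓ → Submodule F V)
    {c : schubertVariety A → F} (hc : c ∈ schubertCode b u A) :
    ∃ φ : V [⋀^Fin ℓ]→ₗ[F] F, ∀ Q : schubertVariety A,
      c Q = φ fun i => (u ⟨Q.1, Q.2.1⟩ i : V) := by
  obtain ⟨_, ⟨f, hf, rfl⟩, rfl⟩ := hc
  obtain ⟨φ, hφ⟩ := exists_alternatingMap_of_mem_minorForms b u hf
  exact ⟨φ, fun Q => hφ _⟩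

open Classical in
/-- The word supported on the span of `v` whose product with the word of an alternating form `φ`
is `φ v`. -/
noncomputable def pluckerWord (u : ∀ P : grassmannian F V ℓ, Basis (Fin ℓ) F P.1)
    (A : Fin ℓ → Submodule F V) (v : Fin ℓ → V) (Q : schubertVariety A) : F :=
  if h : Submodule.span F (Set.range v) = Q.1 then
    (u ⟨Q.1, Q.2.1⟩).det fun i => ⟨v i, h ▸ Submodule.subset_span (Set.mem_range_self i)⟩
  else 0

theorem pluckerWord_eq_zero (u : ∀ P : grassmannian F V ℓ, Basis (Fin ℓ) F P.1)
    (A : Fin ℓ → Submodule F V) {v : Fin ℓ → V} {Q : schubertVariety A}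
    (h : Submodule.span F (Set.range v) ≠ Q.1) : pluckerWord u A v Q = 0 :=
  dif_neg h

/-- Alternating forms of top degree on `Q` are multiples of the determinant, so passing from the
chosen basis to `v` only multiplies by a determinant. This removes the dependence on `u`. -/
theorem map_eq_pluckerWord_mul (u : ∀ P : grassmannian F V ℓ, Basis (Fin ℓ) F P.1)
    (A : Fin ℓ → Submodule F V) {v : Fin ℓ → V} {Q : schubertVariety A}
    (h : Submodule.span F (Set.range v) = Q.1) (φ : V [⋀^Fin ℓ]→ₗ[F] F) :
    pluckerWord u A v Q * φ (fun i => (u ⟨Q.1, Q.2.1⟩ i : V)) = φ v := by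
  have h1 := (φ.compLinearMap Q.1.subtype).eq_smul_basis_det (u ⟨Q.1, Q.2.1⟩)
  have h2 := congrArg
    (fun ψ => ψ fun i => ⟨v i, h ▸ Submodule.subset_span (Set.mem_range_self i)⟩) h1
  rw [pluckerWord, dif_pos h, mul_comm]
  exact h2.symm

theorem pluckerWord_ne_zero (u : ∀ P : grassmannian F V ℓ, Basis (Fin ℓ) F P.1)
    (A : Fin ℓ → Submodule F V) {v : Fin ℓ → V} {Q : schubertVariety A}
    (h : Submodule.span F (Set.range v) = Q.1) : pluckerWord u A v Q ≠ 0 := by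
  rw [pluckerWord, dif_pos h, ← isUnit_iff_ne_zero, ← Basis.is_basis_iff_det]
  have hs : ⊤ ≤ Submodule.span F (Set.range fun i =>
      (⟨v i, h ▸ Submodule.subset_span (Set.mem_range_self i)⟩ : Q.1)) := by
    rw [← Submodule.map_le_map_iff_of_injective Q.1.injective_subtype, Submodule.map_span,
      ← Set.range_comp, Submodule.map_top, Submodule.range_subtype]
    exact h.ge
  refine ⟨?_, top_le_iff.1 hs⟩
  exact linearIndependent_of_top_le_span_of_card_eq_finrank hs
    (by rw [Fintype.card_fin]; exact Q.2.1.symm)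

variable [Finite V]

theorem pluckerWord_dotProduct (u : ∀ P : grassmannian F V ℓ, Basis (Fin ℓ) F P.1)
    (A : Fin ℓ → Submodule F V) {v : Fin ℓ → V}
    (h : Submodule.span F (Set.range v) ∈ schubertVariety A) (φ : V [⋀^Fin ℓ]→ₗ[F] F)
    {c : schubertVariety A → F} (hc : ∀ Q : schubertVariety A,
      c Q = φ fun i => (u ⟨Q.1, Q.2.1⟩ i : V)) :
    pluckerWord u A v ⬝ᵥ c = φ v := by
  rw [dotProduct, Finset.sum_eq_single ⟨_, h⟩]
  · rw [hc, map_eq_pluckerWord_mul]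
    rfl
  · intro Q _ hQ
    rw [pluckerWord_eq_zero, zero_mul]
    exact fun hv => hQ (Subtype.ext hv.symm)
  · simp

open Classical in
/-- The parity check at the span `P` of `p` read off from a relation
`φ p = ∑ e ∈ s, r e * φ (v e)` valid for all alternating forms `φ`. -/
noncomputable def relationCheck (u : ∀ P : grassmannian F V ℓ, Basis (Fin ℓ) F P.1)
    (A : Fin ℓ → Submodule F V) (P : schubertVariety A) (p : Fin ℓ → V) {E : Type*}
    (s : Finset E) (r : E → F) (v : E → Fin ℓ → V) : schubertVariety A → F :=
  (pluckerWord u A p P)⁻¹ • (pluckerWord u A p - ∑ e ∈ s, r e • pluckerWord u A (v e))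

variable [DecidableEq F]

/-- Relations between `P` and other points of the Schubert variety, no point being used twice, give
parity checks orthogonal on `P`. -/
theorem exists_isOrthogonalOn_of_relations (b : Basis (Fin m) F V)
    (u : ∀ P : grassmannian F V ℓ, Basis (Fin ℓ) F P.1) (A : Fin ℓ → Submodule F V)
    (P : schubertVariety A) {p : Fin ℓ → V} (hp : Submodule.span F (Set.range p) = P.1)
    {E I : Type*} [Fintype E] [Fintype I] [DecidableEq I] {π : E → I}
    (hπ : Function.Surjective π)
    {r : E → F} (hr : ∀ e, r e ≠ 0) {v : E → Fin ℓ → V}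
    (hv : ∀ e, Submodule.span F (Set.range (v e)) ∈ schubertVariety A)
    (hvP : ∀ e, Submodule.span F (Set.range (v e)) ≠ P.1)
    (hinj : Function.Injective fun e => Submodule.span F (Set.range (v e)))
    (hrel : ∀ (φ : V [⋀^Fin ℓ]→ₗ[F] F) (i : I),
      ∑ e with π e = i, r e * φ (v e) = φ p) :
    ∃ 𝒥 : Finset (schubertVariety A → F), 𝒥.card = Fintype.card I ∧
      IsOrthogonalOn (schubertCode b u A) 𝒥 P ∧
      (∀ w ∈ 𝒥, ∃ Q, Q ≠ P ∧ w Q ≠ 0) ∧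
      ∀ w ∈ 𝒥, ∀ Q, Q ≠ P → w Q ≠ 0 → ∃ e, Submodule.span F (Set.range (v e)) = Q.1 := by
  classical
  set w : I → schubertVariety A → F :=
    fun i => relationCheck u A P p (Finset.univ.filter fun e => π e = i) r v with hw
  have hd : pluckerWord u A p P ≠ 0 := pluckerWord_ne_zero u A hp
  have hwP : ∀ i, w i P = 1 := by
    intro i
    simp only [hw, relationCheck, Pi.smul_apply, Pi.sub_apply, Finset.sum_apply, smul_eq_mul]
    rw [Finset.sum_eq_zero, sub_zero, inv_mul_cancel₀ hd]
    intro e _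
    rw [pluckerWord_eq_zero u A (hvP e), mul_zero]
  have hsupp : ∀ i Q, Q ≠ P → w i Q ≠ 0 →
      ∃ e, π e = i ∧ Submodule.span F (Set.range (v e)) = Q.1 := by
    intro i Q hQ hne
    by_contra! hcon
    apply hne
    simp only [hw, relationCheck, Pi.smul_apply, Pi.sub_apply, Finset.sum_apply, smul_eq_mul]
    rw [Finset.sum_eq_zero, pluckerWord_eq_zero u A (v := p) (Q := Q), sub_zero, mul_zero]
    · rw [hp]
      exact fun h => hQ (Subtype.ext h.symm)
    · intro e he
      rw [pluckerWord_eq_zero u A (hcon e (Finset.mem_filter.1 he).2), mul_zero]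
  have huniq : ∀ i j Q, Q ≠ P → w i Q ≠ 0 → w j Q ≠ 0 → i = j := by
    intro i j Q hQ hi hj
    obtain ⟨e, rfl, he⟩ := hsupp i Q hQ hi
    obtain ⟨e', rfl, he'⟩ := hsupp j Q hQ hj
    rw [hinj (he.trans he'.symm)]
  -- Distinct indices have distinct spans, so no other term of the relation can cancel the entry at
  -- the span of `v e`.
  have hnz : ∀ e, w (π e) ⟨_, hv e⟩ ≠ 0 := by
    intro e
    simp only [hw, relationCheck, Pi.smul_apply, Pi.sub_apply, Finset.sum_apply, smul_eq_mul]
    rw [Finset.sum_eq_single e, pluckerWord_eq_zero u A (v := p) (Q := ⟨_, hv e⟩), zero_sub]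
    · exact mul_ne_zero (inv_ne_zero hd)
        (neg_ne_zero.2 (mul_ne_zero (hr e) (pluckerWord_ne_zero u A rfl)))
    · rw [hp]
      exact (hvP e).symm
    · intro e' _ hne
      rw [pluckerWord_eq_zero, mul_zero]
      exact fun h => hne (hinj h)
    · simp
  have hwinj : Function.Injective w := by
    intro i j hij
    -- Surjectivity of `π` gives each check a non-zero entry outside `P`, which no other check
    -- shares; hence distinct indices give distinct checks.
    obtain ⟨e, rfl⟩ := hπ i
    refine huniq _ _ ⟨_, hv e⟩ (fun h => hvP e (congrArg Subtype.val h)) (hnz e) ?_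
    rw [← hij]
    exact hnz e
  refine ⟨Finset.univ.image w, ?_, ⟨?_, ?_, ?_⟩, ?_, ?_⟩
  · rw [Finset.card_image_of_injective _ hwinj, Finset.card_univ]
  · intro x hx
    obtain ⟨i, -, rfl⟩ := Finset.mem_image.1 hx
    intro c hc
    obtain ⟨φ, hφ⟩ := exists_alternatingMap_of_mem_schubertCode b u A hc
    have hpP : Submodule.span F (Set.range p) ∈ schubertVariety A := hp ▸ P.2
    simp only [hw, relationCheck]
    rw [smul_dotProduct, sub_dotProduct, sum_dotProduct, pluckerWord_dotProduct u A hpP φ hφ,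
      Finset.sum_congr rfl fun e _ => by
        rw [smul_dotProduct, pluckerWord_dotProduct u A (hv e) φ hφ, smul_eq_mul],
      hrel φ i, sub_self, smul_zero]
  · intro x hx
    obtain ⟨i, -, rfl⟩ := Finset.mem_image.1 hx
    exact hwP i
  · intro Q hQ
    rw [Finset.card_le_one]
    intro x hx y hy
    simp only [Finset.mem_filter, Finset.mem_image, Finset.mem_univ, true_and] at hx hy
    obtain ⟨⟨i, rfl⟩, hi⟩ := hx
    obtain ⟨⟨j, rfl⟩, hj⟩ := hy
    rw [huniq i j Q hQ hi hj]
  · intro x hx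
    obtain ⟨i, -, rfl⟩ := Finset.mem_image.1 hx
    obtain ⟨e, rfl⟩ := hπ i
    exact ⟨_, fun h => hvP e (congrArg Subtype.val h), hnz e⟩
  · intro x hx Q hQ hne
    obtain ⟨i, -, rfl⟩ := Finset.mem_image.1 hx
    obtain ⟨e, -, he⟩ := hsupp i Q hQ hne
    exact ⟨e, he⟩

end PluckerWords

/-! ### Subsets and unions of orthogonal sets. -/

section OrthogonalSets

variable {F ι : Type*} [Field F] [DecidableEq F] [Fintype ι]
  {C : Submodule F (ι → F)} {i : ι}

theorem IsOrthogonalOn.mono {𝒥 𝒥' : Finset (ι → F)} (h : IsOrthogonalOn C 𝒥 i) (hs : 𝒥' ⊆ 𝒥) :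
    IsOrthogonalOn C 𝒥' i where
  parityCheck w hw := h.parityCheck w (hs hw)
  eq_one w hw := h.eq_one w (hs hw)
  column_weight j hj :=
    (Finset.card_le_card (Finset.filter_subset_filter _ hs)).trans (h.column_weight j hj)

/-- Two orthogonal sets whose supports meet only in the coordinate `i` have an orthogonal union. -/
theorem IsOrthogonalOn.exists_union {𝒥₁ 𝒥₂ : Finset (ι → F)} (h₁ : IsOrthogonalOn C 𝒥₁ i)
    (h₂ : IsOrthogonalOn C 𝒥₂ i) (hne : ∀ w ∈ 𝒥₁, ∃ j, j ≠ i ∧ w j ≠ 0)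
    (hdisj : ∀ w₁ ∈ 𝒥₁, ∀ w₂ ∈ 𝒥₂, ∀ j, j ≠ i → w₁ j ≠ 0 → w₂ j ≠ 0 → False) :
    ∃ 𝒥 : Finset (ι → F), 𝒥.card = 𝒥₁.card + 𝒥₂.card ∧ IsOrthogonalOn C 𝒥 i := by
  classical
  refine ⟨𝒥₁ ∪ 𝒥₂, Finset.card_union_of_disjoint ?_, ⟨?_, ?_, ?_⟩⟩
  · rw [Finset.disjoint_left]
    intro w hw₁ hw₂
    obtain ⟨j, hj, hwj⟩ := hne w hw₁
    exact hdisj w hw₁ w hw₂ j hj hwj hwj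
  · exact fun w hw => (Finset.mem_union.1 hw).elim (h₁.parityCheck w) (h₂.parityCheck w)
  · exact fun w hw => (Finset.mem_union.1 hw).elim (h₁.eq_one w) (h₂.eq_one w)
  · intro j hj
    have k₁ := Finset.card_le_one.1 (h₁.column_weight j hj)
    have k₂ := Finset.card_le_one.1 (h₂.column_weight j hj)
    simp only [Finset.mem_filter] at k₁ k₂
    rw [Finset.card_le_one]
    intro x hx y hy
    simp only [Finset.mem_filter, Finset.mem_union] at hx hy
    rcases hx with ⟨hx | hx, hxj⟩ <;> rcases hy with ⟨hy | hy, hyj⟩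
    · exact k₁ x ⟨hx, hxj⟩ y ⟨hy, hyj⟩
    · exact (hdisj x hx y hy j hj hxj hyj).elim
    · exact (hdisj y hy x hx j hj hyj hxj).elim
    · exact k₂ x ⟨hx, hxj⟩ y ⟨hy, hyj⟩

end OrthogonalSets

/-! ### Counting lines and planes through their ordered bases. -/

section CountingSubspaces

open Module Submodule

theorem Set.ncard_eq_ncard_mul_of_fibers {α β : Type*} [Finite α] [Finite β] {s : Set α} {t : Set β}
    {f : α → β} {N : ℕ} (hf : Set.MapsTo f s t) (hN : ∀ y ∈ t, {x ∈ s | f x = y}.ncard = N) :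
    s.ncard = t.ncard * N := by
  classical
  have := Fintype.ofFinite α
  have := Fintype.ofFinite β
  rw [Set.ncard_eq_toFinset_card', Set.ncard_eq_toFinset_card',
    Finset.card_eq_sum_card_fiberwise (f := f) (t := t.toFinset)
      (by intro x hx; simpa using hf (by simpa using hx))]
  rw [Finset.sum_const_nat (m := N)]
  intro y hy
  rw [← hN y (by simpa using hy), Set.ncard_eq_toFinset_card']
  congr 1
  ext x
  simp

theorem finrank_span_pair_eq_two {F V : Type*} [Field F] [AddCommGroup V] [Module F V]
    {B : Submodule F V} {x y : V} (hx : x ∈ B) (hx0 : x ≠ 0)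
    (hy : y ∉ B) : finrank F (span F {x, y}) = 2 := by
  have h : LinearIndependent F ![x, y] := by
    rw [LinearIndependent.pair_iff' hx0]
    rintro r rfl
    exact hy (B.smul_mem r hx)
  have := finrank_span_eq_card h
  rwa [Matrix.range_cons, Matrix.range_cons, Matrix.range_empty, Set.union_empty,
    Set.singleton_union, Fintype.card_fin] at this

variable {F V : Type*} [Field F] [Fintype F] [AddCommGroup V] [Module F V] [Finite V]

theorem Submodule.ncard_eq_pow (W : Submodule F V) :
    (W : Set V).ncard = Fintype.card F ^ finrank F W := by
  rw [← Nat.card_eq_fintype_card, ← Module.natCard_eq_pow_finrank (K := F) (V := W)]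
  rfl

theorem Submodule.ncard_diff_zero (W : Submodule F V) :
    ((W : Set V) \ {0}).ncard = Fintype.card F ^ finrank F W - 1 := by
  rw [Set.ncard_sdiff (by simp), W.ncard_eq_pow, Set.ncard_singleton]

theorem Submodule.ncard_diff {B W : Submodule F V} (h : B ≤ W) :
    ((W : Set V) \ B).ncard = Fintype.card F ^ finrank F W - Fintype.card F ^ finrank F B := by
  rw [Set.ncard_sdiff h, W.ncard_eq_pow, B.ncard_eq_pow]

/-- The subspaces of dimension `1` of `W`. -/
def subspaceLines (W : Submodule F V) : Set (Submodule F V) := {S | S ≤ W ∧ finrank F S = 1}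

/-- The planes of `W`. -/
def subspacePlanes (W : Submodule F V) : Set (Submodule F V) := {T | T ≤ W ∧ finrank F T = 2}

/-- The planes of `W` which meet `B` in a subspace of dimension `1`. -/
def secantPlanes (B W : Submodule F V) : Set (Submodule F V) :=
  {T | T ≤ W ∧ finrank F T = 2 ∧ finrank F ↥(T ⊓ B) = 1}

theorem ncard_subspaceLines_mul (W : Submodule F V) :
    (subspaceLines W).ncard * (Fintype.card F - 1) = Fintype.card F ^ finrank F W - 1 := by
  rw [← W.ncard_diff_zero]
  refine (Set.ncard_eq_ncard_mul_of_fibers (f := fun x => span F {x}) ?_ ?_).symm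
  · rintro x ⟨hx, hx0⟩
    exact ⟨(span_singleton_le_iff_mem x W).2 hx, finrank_span_singleton hx0⟩
  · rintro S ⟨hS, hS1⟩
    have : {x ∈ (W : Set V) \ {0} | span F {x} = S} = (S : Set V) \ {0} := by
      ext x
      constructor
      · rintro ⟨⟨-, hx0⟩, rfl⟩
        exact ⟨mem_span_singleton_self x, hx0⟩
      · rintro ⟨hx, hx0⟩
        refine ⟨⟨hS hx, hx0⟩, eq_of_le_of_finrank_eq
          ((span_singleton_le_iff_mem x S).2 hx) ?_⟩
        rw [hS1, finrank_span_singleton hx0]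
    rw [this, S.ncard_diff_zero, hS1, pow_one]

/-- Count pairs `(x, y)` with `x` non-zero in `B` and `y` in `W` outside `B`. Their span meets `B`
only in the line of `x`, and each secant plane `T` arises from a non-zero vector of `T ⊓ B` and a
vector of `T` off that line. -/
theorem ncard_secantPlanes_mul {B W : Submodule F V} (h : B ≤ W) :
    (secantPlanes B W).ncard * ((Fintype.card F - 1) * (Fintype.card F ^ 2 - Fintype.card F)) =
      (Fintype.card F ^ finrank F B - 1) *
        (Fintype.card F ^ finrank F W - Fintype.card F ^ finrank F B) := by
  rw [← B.ncard_diff_zero, ← Submodule.ncard_diff h, ← Set.ncard_prod]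
  refine (Set.ncard_eq_ncard_mul_of_fibers (f := fun x => span F {x.1, x.2}) ?_ ?_).symm
  · rintro ⟨x, y⟩ ⟨⟨hx, hx0⟩, hy, hyB⟩
    have hx0 : x ≠ 0 := hx0
    have h2 : finrank F (span F {x, y}) = 2 := finrank_span_pair_eq_two hx hx0 hyB
    refine ⟨?_, h2, ?_⟩
    · rw [span_le, Set.insert_subset_iff, Set.singleton_subset_iff]
      exact ⟨h hx, hy⟩
    · have h1 : finrank F ↥(span F {x, y} ⊓ B) < 2 := by
        rw [← h2]
        refine finrank_lt_finrank_of_lt (inf_lt_left.2 fun hle => hyB (hle ?_))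
        exact subset_span (by simp)
      have h3 : finrank F (span F {x}) ≤ finrank F ↥(span F {x, y} ⊓ B) := by
        refine finrank_mono (le_inf (span_mono (by simp)) ?_)
        rwa [span_singleton_le_iff_mem]
      rw [finrank_span_singleton hx0] at h3
      change finrank F ↥(span F {x, y} ⊓ B) = 1
      omega
  · rintro T ⟨hT, hT2, hTB⟩
    have : {p ∈ ((B : Set V) \ {0}) ×ˢ ((W : Set V) \ B) | span F {p.1, p.2} = T} =
        (((T ⊓ B : Submodule F V) : Set V) \ {0}) ×ˢ ((T : Set V) \ (T ⊓ B : Submodule F V)) := by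
      ext ⟨x, y⟩
      constructor
      · rintro ⟨⟨⟨hx, hx0⟩, hy, hyB⟩, rfl⟩
        exact ⟨⟨⟨subset_span (by simp), hx⟩, hx0⟩, subset_span (by simp), fun hmem => hyB hmem.2⟩
      · rintro ⟨⟨⟨hxT, hx⟩, hx0⟩, hy, hyB⟩
        have hyB : y ∉ B := fun hmem => hyB ⟨hy, hmem⟩
        refine ⟨⟨⟨hx, hx0⟩, hT hy, hyB⟩, eq_of_le_of_finrank_eq ?_ ?_⟩
        · rw [span_le, Set.insert_subset_iff, Set.singleton_subset_iff]
          exact ⟨hxT, hy⟩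
        · rw [hT2]
          exact finrank_span_pair_eq_two hx hx0 hyB
    rw [this, Set.ncard_prod, ncard_diff_zero, Submodule.ncard_diff inf_le_left, hT2, hTB, pow_one]

theorem ncard_independent_pairs (W : Submodule F V) :
    {p : V × V | p.1 ∈ W ∧ p.1 ≠ 0 ∧ p.2 ∈ W ∧ p.2 ∉ span F {p.1}}.ncard =
      (Fintype.card F ^ finrank F W - 1) * (Fintype.card F ^ finrank F W - Fintype.card F) := by
  rw [← W.ncard_diff_zero]
  refine Set.ncard_eq_ncard_mul_of_fibers (f := Prod.fst) ?_ ?_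
  · rintro ⟨x, y⟩ ⟨hx, hx0, -⟩
    exact ⟨hx, hx0⟩
  · rintro x ⟨hx, hx0⟩
    have hx0 : x ≠ 0 := hx0
    have : {p ∈ {p : V × V | p.1 ∈ W ∧ p.1 ≠ 0 ∧ p.2 ∈ W ∧ p.2 ∉ span F {p.1}} | p.1 = x} =
        {x} ×ˢ ((W : Set V) \ (span F {x} : Submodule F V)) := by
      ext ⟨y, z⟩
      constructor
      · rintro ⟨⟨-, -, hz, hzx⟩, rfl⟩
        exact ⟨rfl, hz, hzx⟩
      · rintro ⟨rfl, hz, hzx⟩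
        exact ⟨⟨hx, hx0, hz, hzx⟩, rfl⟩
    rw [this, Set.ncard_prod, Set.ncard_singleton, one_mul,
      Submodule.ncard_diff ((span_singleton_le_iff_mem x W).2 hx), finrank_span_singleton hx0,
      pow_one]

theorem ncard_subspacePlanes_mul (W : Submodule F V) :
    (subspacePlanes W).ncard *
        ((Fintype.card F ^ 2 - 1) * (Fintype.card F ^ 2 - Fintype.card F)) =
      (Fintype.card F ^ finrank F W - 1) * (Fintype.card F ^ finrank F W - Fintype.card F) := by
  rw [← ncard_independent_pairs W]
  refine (Set.ncard_eq_ncard_mul_of_fibers (f := fun x => span F {x.1, x.2}) ?_ ?_).symm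
  · rintro ⟨x, y⟩ ⟨hx, hx0, hy, hyx⟩
    refine ⟨?_, finrank_span_pair_eq_two (mem_span_singleton_self x) hx0 hyx⟩
    rw [span_le, Set.insert_subset_iff, Set.singleton_subset_iff]
    exact ⟨hx, hy⟩
  · rintro T ⟨hT, hT2⟩
    -- The fibre over `T` is the set of ordered bases of `T`, so the pair count for `T` itself gives
    -- its size.
    rw [← hT2, ← ncard_independent_pairs T]
    congr 1
    ext ⟨x, y⟩
    constructor
    · rintro ⟨⟨-, hx0, -, hyx⟩, rfl⟩
      exact ⟨subset_span (by simp), hx0, subset_span (by simp), hyx⟩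
    · rintro ⟨hx, hx0, hy, hyx⟩
      refine ⟨⟨hT hx, hx0, hT hy, hyx⟩, eq_of_le_of_finrank_eq ?_ ?_⟩
      · rw [span_le, Set.insert_subset_iff, Set.singleton_subset_iff]
        exact ⟨hx, hy⟩
      · rw [hT2]
        exact finrank_span_pair_eq_two (mem_span_singleton_self x) hx0 hyx

end CountingSubspaces

/-! ### Coordinates adapted to a plane and to the flag. -/

section PlaneFrames

open Module Submodule

variable {F V : Type*} [Field F] [AddCommGroup V] [Module F V]

/-- A basis `e₁, e₂` of the plane `P` with `e₁ ∈ A`, together with a subspace `K` and a subspace `B`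
of `K ⊓ A`, and linear maps that separate `e₁`, `e₂` and `K`. -/
structure PlaneFrame (A P : Submodule F V) where
  e₁ : V
  e₂ : V
  K : Submodule F V
  B : Submodule F V
  proj : V →ₗ[F] V
  c₁ : V →ₗ[F] F
  c₂ : V →ₗ[F] F
  span_eq : span F (Set.range ![e₁, e₂]) = P
  e₁_mem : e₁ ∈ A
  B_le_K : B ≤ K
  B_le_A : B ≤ A
  proj_e₁ : proj e₁ = 0
  proj_e₂ : proj e₂ = 0
  proj_of_mem : ∀ k ∈ K, proj k = k
  c₁_e₁ : c₁ e₁ = 1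
  c₁_e₂ : c₁ e₂ = 0
  c₂_e₁ : c₂ e₁ = 0
  c₂_e₂ : c₂ e₂ = 1

theorem span_range_pair (x y : V) : span F (Set.range ![x, y]) = span F {x, y} := by
  rw [Matrix.range_cons, Matrix.range_cons, Matrix.range_empty, Set.union_empty,
    Set.singleton_union]

/-- A plane with a non-zero vector of `A` has an ordered basis starting in `A`. -/
theorem exists_pair_of_finrank_eq_two {T A : Submodule F V} (hT : finrank F T = 2)
    (hA : T ⊓ A ≠ ⊥) : ∃ x y, x ∈ A ∧ LinearIndependent F ![x, y] ∧ span F {x, y} = T := by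
  have : FiniteDimensional F T := .of_finrank_pos (by omega)
  obtain ⟨x, ⟨hxT, hxA⟩, hx0⟩ := (Submodule.ne_bot_iff _).1 hA
  have hlt : span F {x} < T := by
    refine lt_of_le_of_ne ((span_singleton_le_iff_mem x T).2 hxT) ?_
    rintro rfl
    rw [finrank_span_singleton hx0] at hT
    omega
  obtain ⟨y, hy, hyx⟩ := SetLike.exists_of_lt hlt
  refine ⟨x, y, hxA, ?_, eq_of_le_of_finrank_eq ?_ ?_⟩
  · rw [LinearIndependent.pair_iff' hx0]
    rintro r rfl
    exact hyx (mem_span_singleton.2 ⟨r, rfl⟩)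
  · rw [span_le, Set.insert_subset_iff, Set.singleton_subset_iff]
    exact ⟨hxT, hy⟩
  · rw [hT]
    exact finrank_span_pair_eq_two (mem_span_singleton_self x) hx0 hyx

/-- Modularity provides a complement `B` of `P ⊓ A` in `A`. It is disjoint from `P`, hence extends
to a complement `K` of `P`; the projections of this decomposition supply the linear maps. -/
theorem PlaneFrame.exists_of_finrank [FiniteDimensional F V] {A P : Submodule F V}
    (hP : finrank F P = 2) (hPA : P ⊓ A ≠ ⊥) :
    ∃ f : PlaneFrame A P, finrank F f.K + 2 = finrank F V ∧
      finrank F f.B + finrank F ↥(P ⊓ A) = finrank F A := by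
  obtain ⟨x, y, hx, hli, hspan⟩ := exists_pair_of_finrank_eq_two hP hPA
  obtain ⟨B, hB, hsup⟩ :=
    IsModularLattice.exists_disjoint_and_sup_eq (inf_le_right : P ⊓ A ≤ A)
  have hBA : B ≤ A := hsup ▸ le_sup_right
  have hdisj : Disjoint P B := by
    rw [disjoint_iff, ← inf_eq_right.2 hBA, ← inf_assoc]
    exact hB.eq_bot
  have hfB : finrank F B + finrank F ↥(P ⊓ A) = finrank F A := by
    have h := Submodule.finrank_sup_add_finrank_inf_eq (P ⊓ A) B
    rw [hsup, (hdisj.mono_left inf_le_left).eq_bot, finrank_bot] at h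
    omega
  obtain ⟨K, hBK, hK⟩ := hdisj.symm.exists_isCompl
  have hfK := Submodule.finrank_add_eq_of_isCompl hK
  set bP : Basis (Fin 2) F P := (Basis.span hli).map
    (LinearEquiv.ofEq _ _ ((span_range_pair x y).trans hspan)) with hbP
  have hb0 : (bP 0 : V) = x := by simp [hbP, Basis.span_apply]
  have hb1 : (bP 1 : V) = y := by simp [hbP, Basis.span_apply]
  have hxP : x ∈ P := hb0 ▸ (bP 0).2
  have hyP : y ∈ P := hb1 ▸ (bP 1).2
  have e0 : (⟨x, hxP⟩ : P) = bP 0 := Subtype.ext hb0.symm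
  have e1 : (⟨y, hyP⟩ : P) = bP 1 := Subtype.ext hb1.symm
  set pr := P.projectionOnto K hK.symm with hpr
  have hprx : pr x = bP 0 := by
    rw [← e0]; exact Submodule.projectionOnto_apply_left hK.symm ⟨x, hxP⟩
  have hpry : pr y = bP 1 := by
    rw [← e1]; exact Submodule.projectionOnto_apply_left hK.symm ⟨y, hyP⟩
  refine ⟨⟨x, y, K, B, K.subtype ∘ₗ K.projectionOnto P hK,
    bP.coord 0 ∘ₗ pr, bP.coord 1 ∘ₗ pr, (span_range_pair x y).trans hspan, hx, hBK, hBA,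
    ?_, ?_, ?_, ?_, ?_, ?_, ?_⟩, by simp only; omega, hfB⟩
  · simp [Submodule.projectionOnto_apply_of_mem_right hK hxP]
  · simp [Submodule.projectionOnto_apply_of_mem_right hK hyP]
  · intro k hk
    have := Submodule.projectionOnto_apply_left hK ⟨k, hk⟩
    simp [this]
  all_goals simp [hprx, hpry]

end PlaneFrames

/-! ### Points of the Schubert variety on lines through the plane and in grids. -/

section PlaneFrames

open Module Submodule

variable {F V : Type*} [Field F] [AddCommGroup V] [Module F V]

theorem span_pair_mem_schubertVariety [FiniteDimensional F V] {A : Fin 2 → Submodule F V}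
    (hA : A 1 = ⊤) {x y z : V} (h : LinearIndependent F ![x, y]) (hz : z ∈ span F {x, y})
    (hzA : z ∈ A 0) (hz0 : z ≠ 0) : span F (Set.range ![x, y]) ∈ schubertVariety A := by
  have h2 : finrank F (span F (Set.range ![x, y])) = 2 := by
    rw [_root_.finrank_span_eq_card h, Fintype.card_fin]
  refine ⟨h2, fun i => ?_⟩
  fin_cases i
  · change 0 + 1 ≤ _
    rw [zero_add, Submodule.one_le_finrank_iff, Submodule.ne_bot_iff]
    exact ⟨z, ⟨(span_range_pair (F := F) x y).ge hz, hzA⟩, hz0⟩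
  · change 1 + 1 ≤ finrank F ↥(_ ⊓ A 1)
    rw [hA, inf_top_eq, h2]

open Classical in
/-- A vector spanning a subspace of dimension `1`. -/
noncomputable def spanningVector (S : Submodule F V) : V :=
  if h : ∃ w, span F {w} = S then h.choose else 0

theorem span_spanningVector {S : Submodule F V} (hS : finrank F S = 1) :
    span F {spanningVector S} = S := by
  have h : ∃ w, span F {w} = S := by
    have : FiniteDimensional F S := .of_finrank_pos (by omega)
    obtain ⟨w, hw, hw0⟩ := (Submodule.ne_bot_iff S).1 (by rintro rfl; simp at hS)
    exact ⟨w, eq_of_le_of_finrank_eq ((span_singleton_le_iff_mem w S).2 hw)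
      (by rw [hS, finrank_span_singleton hw0])⟩
  rw [spanningVector, dif_pos h]
  exact h.choose_spec

theorem spanningVector_mem {S : Submodule F V} (hS : finrank F S = 1) : spanningVector S ∈ S :=
  (span_spanningVector hS).le (mem_span_singleton_self _)

theorem spanningVector_ne_zero {S : Submodule F V} (hS : finrank F S = 1) :
    spanningVector S ≠ 0 := by
  intro h
  have := span_spanningVector hS
  rw [h, span_zero_singleton] at this
  rw [← this, finrank_bot] at hS
  omega

open Classical in
/-- An ordered basis of the plane `T` whose first vector lies in `B` if possible. -/
noncomputable def planePair (B T : Submodule F V) : V × V :=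
  if h : ∃ p : V × V, p.1 ∈ B ∧ LinearIndependent F ![p.1, p.2] ∧ span F {p.1, p.2} = T then
    h.choose else 0

theorem planePair_spec {B T : Submodule F V} (hT : finrank F T = 2) (hB : T ⊓ B ≠ ⊥) :
    (planePair B T).1 ∈ B ∧ LinearIndependent F ![(planePair B T).1, (planePair B T).2] ∧
      span F {(planePair B T).1, (planePair B T).2} = T := by
  have h : ∃ p : V × V, p.1 ∈ B ∧ LinearIndependent F ![p.1, p.2] ∧ span F {p.1, p.2} = T := by
    obtain ⟨x, y, h⟩ := exists_pair_of_finrank_eq_two hT hB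
    exact ⟨(x, y), h⟩
  rw [planePair, dif_pos h]
  exact h.choose_spec

theorem map_span_range_pair (g : V →ₗ[F] V) (x y : V) :
    (span F (Set.range ![x, y])).map g = span F {g x, g y} := by
  rw [span_range_pair, map_span, Set.image_pair]

theorem map_pair_swap (φ : V [⋀^Fin 2]→ₗ[F] F) (x y : V) : φ ![y, x] = -φ ![x, y] := by
  rw [← φ.map_swap ![x, y] (i := 0) (j := 1) (by decide)]
  congr 1
  ext i
  fin_cases i <;> rfl

theorem map_pair_self (φ : V [⋀^Fin 2]→ₗ[F] F) (x : V) : φ ![x, x] = 0 :=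
  φ.map_eq_zero_of_eq _ (i := 0) (j := 1) rfl (by decide)

theorem map_pair_add_left (φ : V [⋀^Fin 2]→ₗ[F] F) (x x' y : V) :
    φ ![x + x', y] = φ ![x, y] + φ ![x', y] :=
  φ.map_vecCons_add ![y] x x'

theorem map_pair_smul_left (φ : V [⋀^Fin 2]→ₗ[F] F) (r : F) (x y : V) :
    φ ![r • x, y] = r * φ ![x, y] :=
  φ.map_vecCons_smul ![y] r x

theorem map_pair_add_right (φ : V [⋀^Fin 2]→ₗ[F] F) (x y y' : V) :
    φ ![x, y + y'] = φ ![x, y] + φ ![x, y'] := by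
  rw [map_pair_swap, map_pair_add_left, map_pair_swap φ x, map_pair_swap φ x]
  ring

theorem map_pair_smul_right (φ : V [⋀^Fin 2]→ₗ[F] F) (r : F) (x y : V) :
    φ ![x, r • y] = r * φ ![x, y] := by
  rw [map_pair_swap, map_pair_smul_left, map_pair_swap φ x]
  ring

namespace PlaneFrame

variable {A P : Submodule F V} (f : PlaneFrame A P)

theorem e₁_mem_plane : f.e₁ ∈ P := f.span_eq.le (subset_span ⟨0, rfl⟩)

theorem e₂_mem_plane : f.e₂ ∈ P := f.span_eq.le (subset_span ⟨1, rfl⟩)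

theorem map_proj_plane : P.map f.proj = ⊥ := by
  rw [← show map f.proj _ = map f.proj P from congrArg _ f.span_eq, map_span_range_pair, f.proj_e₁,
    f.proj_e₂]
  simp

/-- This dichotomy decides whether a secant plane carries `q` or `q ^ 2` grids. -/
theorem smul_e₂_mem_iff {ν : F} : ν • f.e₂ ∈ A ↔ ν = 0 ∨ P ≤ A := by
  constructor
  · intro h
    by_cases hν : ν = 0
    · exact .inl hν
    · right
      rw [← f.span_eq, span_range_pair, span_le, Set.insert_subset_iff, Set.singleton_subset_iff]
      exact ⟨f.e₁_mem, (A.smul_mem_iff hν).1 h⟩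
  · rintro (rfl | h)
    · simp
    · exact A.smul_mem ν (h f.e₂_mem_plane)

/-- Vectors spanning the lines of the plane. -/
def dir : Option F → V
  | none => f.e₁
  | some s => f.e₂ + s • f.e₁

/-- A vector completing `f.dir U` to a basis of the plane. -/
def codir : Option F → V
  | none => f.e₂
  | some _ => f.e₁

/-- The determinant of `f.dir U, f.codir U`. -/
def sign (_ : PlaneFrame A P) : Option F → F
  | none => 1
  | some _ => -1

theorem sign_ne_zero (U : Option F) : f.sign U ≠ 0 := by
  cases U <;> simp [sign]

theorem sign_mul_self (U : Option F) : f.sign U * f.sign U = 1 := by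
  cases U <;> simp [sign]

theorem proj_dir (U : Option F) : f.proj (f.dir U) = 0 := by
  cases U <;> simp [dir, f.proj_e₁, f.proj_e₂]

theorem proj_codir (U : Option F) : f.proj (f.codir U) = 0 := by
  cases U <;> simp [codir, f.proj_e₁, f.proj_e₂]

theorem dir_mem (U : Option F) : f.dir U ∈ P := by
  cases U
  · exact f.e₁_mem_plane
  · exact P.add_mem f.e₂_mem_plane (P.smul_mem _ f.e₁_mem_plane)

theorem dir_ne_zero (U : Option F) : f.dir U ≠ 0 := by
  intro h
  cases U
  · have := f.c₁_e₁
    rw [show f.e₁ = 0 from h, map_zero] at this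
    exact zero_ne_one this
  · have := congrArg f.c₂ h
    simp [dir, f.c₂_e₁, f.c₂_e₂] at this

theorem eq_of_dir_eq_smul {U U' : Option F} {r : F} (h : f.dir U = r • f.dir U') : U = U' := by
  have h₁ := congrArg f.c₁ h
  have h₂ := congrArg f.c₂ h
  cases U <;> cases U' <;>
    simp [dir, f.c₁_e₁, f.c₁_e₂, f.c₂_e₁, f.c₂_e₂] at h₁ h₂ ⊢
  · rw [← h₂] at h₁
    simp at h₁
  · rw [h₁, ← h₂, one_mul]

theorem eq_zero_of_smul_codir_eq {U : Option F} {r s : F} (h : s • f.codir U = r • f.dir U) :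
    s = 0 := by
  have h₁ := congrArg f.c₁ h
  have h₂ := congrArg f.c₂ h
  cases U <;>
    simp [dir, codir, f.c₁_e₁, f.c₁_e₂, f.c₂_e₁, f.c₂_e₂] at h₁ h₂ ⊢
  · exact h₂
  · rw [h₁, ← h₂, zero_mul]

/-- The lines through `P` in the Schubert variety, given by a line of `P` and a line of `K`. -/
def lines : Set (Option F × Submodule F V) :=
  {x | x.2 ∈ subspaceLines f.K ∧ (x.1 = none ∨ x.2 ≤ f.B ∨ P ≤ A)}

/-- The points other than `P` of the lines through `P`. -/
noncomputable def linePoint (x : Option F × Submodule F V) (t : F) : Fin 2 → V :=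
  ![f.dir x.1, spanningVector x.2 + t • f.codir x.1]

theorem proj_spanningVector {x : Option F × Submodule F V} (hx : x ∈ f.lines) :
    f.proj (spanningVector x.2) = spanningVector x.2 :=
  f.proj_of_mem _ (hx.1.1 (spanningVector_mem hx.1.2))

theorem map_linePoint {x : Option F × Submodule F V} (hx : x ∈ f.lines) (t : F) :
    (span F (Set.range (f.linePoint x t))).map f.proj = x.2 := by
  rw [linePoint, map_span_range_pair, map_add, map_smul, f.proj_dir, f.proj_codir,
    f.proj_spanningVector hx, smul_zero, add_zero, span_insert_zero, span_spanningVector hx.1.2]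

/-- Projection along `P` recovers the line of `K`. Comparing its components in an expression of one
generator by the others then identifies the direction in `P` and the parameter. -/
theorem linePoint_injective {x x' : Option F × Submodule F V} (hx : x ∈ f.lines)
    (hx' : x' ∈ f.lines) {t t' : F}
    (h : span F (Set.range (f.linePoint x t)) = span F (Set.range (f.linePoint x' t'))) :
    x = x' ∧ t = t' := by
  obtain ⟨U, S⟩ := x
  obtain ⟨U', S'⟩ := x'
  obtain rfl : S = S' := by
    rw [← show _ = S from f.map_linePoint hx t, h, f.map_linePoint hx']
  have hw0 := spanningVector_ne_zero hx.1.2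
  have hpw := f.proj_spanningVector hx
  simp only at hw0 hpw
  rw [linePoint, linePoint, span_range_pair, span_range_pair] at h
  obtain rfl : U = U' := by
    have : f.dir U ∈ span F {f.dir U', spanningVector S + t' • f.codir U'} :=
      h ▸ subset_span (by simp)
    obtain ⟨r, s, hrs⟩ := mem_span_pair.1 this
    have h1 := congrArg f.proj hrs
    simp only [map_add, map_smul, f.proj_dir, f.proj_codir, smul_zero, zero_add, add_zero, hpw]
      at h1
    rcases smul_eq_zero.1 h1 with rfl | h1
    · rw [zero_smul, add_zero] at hrs
      exact f.eq_of_dir_eq_smul hrs.symm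
    · exact (hw0 h1).elim
  refine ⟨rfl, ?_⟩
  have : spanningVector S + t • f.codir U ∈
      span F {f.dir U, spanningVector S + t' • f.codir U} := h ▸ subset_span (by simp)
  obtain ⟨r, s, hrs⟩ := mem_span_pair.1 this
  have h1 := congrArg f.proj hrs
  simp only [map_add, map_smul, f.proj_dir, f.proj_codir, smul_zero, zero_add, add_zero, hpw] at h1
  have hs : s = 1 := by
    have h2 : (s - 1) • spanningVector S = 0 := by rw [sub_smul, h1, one_smul, sub_self]
    rcases smul_eq_zero.1 h2 with h2 | h2
    · exact sub_eq_zero.1 h2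
    · exact (hw0 h2).elim
  subst hs
  refine sub_eq_zero.1 (f.eq_zero_of_smul_codir_eq (U := U) (r := r) ?_)
  rw [sub_smul, sub_eq_iff_eq_add]
  have := congrArg (fun z => z - spanningVector S) hrs
  simp only [one_smul, add_sub_cancel_left] at this
  rw [← this]
  abel

theorem linearIndependent_linePoint {x : Option F × Submodule F V} (hx : x ∈ f.lines) (t : F) :
    LinearIndependent F (f.linePoint x t) := by
  rw [linePoint, LinearIndependent.pair_iff' (f.dir_ne_zero _)]
  intro r h
  have h1 := congrArg f.proj h
  simp only [map_add, map_smul, f.proj_dir, f.proj_codir, smul_zero, add_zero,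
    f.proj_spanningVector hx] at h1
  exact spanningVector_ne_zero hx.1.2 h1.symm

/-- Either the direction in `P` already lies in `A`, or the second generator does: its `K`-part is
in `B` and `f.codir` is then `e₁`, which lies in `A`. -/
theorem exists_linePoint_mem {x : Option F × Submodule F V} (hx : x ∈ f.lines) (t : F) :
    ∃ z ∈ span F {f.dir x.1, spanningVector x.2 + t • f.codir x.1}, z ∈ A ∧ z ≠ 0 := by
  have h0 : f.dir x.1 ∈ span F {f.dir x.1, spanningVector x.2 + t • f.codir x.1} :=
    subset_span (by simp)
  by_cases hd : f.dir x.1 ∈ A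
  · exact ⟨_, h0, hd, f.dir_ne_zero _⟩
  obtain ⟨U, S⟩ := x
  rcases hx.2 with h | h | h
  · simp only at h
    subst h
    exact (hd f.e₁_mem).elim
  · refine ⟨_, subset_span (Set.mem_insert_of_mem _ rfl), ?_, ?_⟩
    · cases U
      · exact (hd f.e₁_mem).elim
      · exact A.add_mem (f.B_le_A (h (spanningVector_mem hx.1.2))) (A.smul_mem _ f.e₁_mem)
    · intro hz
      have h1 := congrArg f.proj hz
      rw [map_add, map_smul, f.proj_codir, f.proj_spanningVector hx, smul_zero, add_zero,
        map_zero] at h1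
      exact spanningVector_ne_zero hx.1.2 h1
  · exact (hd (h (f.dir_mem _))).elim

/-- Three points of a line through `P` are dependent. -/
theorem map_linePoint_sub (φ : V [⋀^Fin 2]→ₗ[F] F) (x : Option F × Submodule F V) (t t' : F) :
    φ (f.linePoint x t) - φ (f.linePoint x t') =
      (t - t') * (f.sign x.1 * φ ![f.e₁, f.e₂]) := by
  obtain ⟨U, S⟩ := x
  cases U
  · simp only [linePoint, dir, codir, sign, map_pair_add_right, map_pair_smul_right]
    ring
  · simp only [linePoint, dir, codir, sign, map_pair_add_right, map_pair_smul_right,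
      map_pair_add_left, map_pair_smul_left, map_pair_self, map_pair_swap φ f.e₁ f.e₂]
    ring

/-- Data for the grids of points of the Schubert variety that meet `P` trivially. -/
def grids : Set (Submodule F V × F × F) :=
  {g | g.1 ∈ secantPlanes f.B f.K ∧ g.2.1 • f.e₂ ∈ A ∨ g.1 ∈ subspacePlanes f.B}

theorem grids_eq : f.grids = (secantPlanes f.B f.K ×ˢ {ν : F | ν • f.e₂ ∈ A} ×ˢ Set.univ) ∪
    subspacePlanes f.B ×ˢ Set.univ ×ˢ Set.univ := by
  ext g
  simp [grids]

/-- The points of a grid. -/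
noncomputable def gridPoint (g : Submodule F V × F × F) (s t : F) : Fin 2 → V :=
  ![(planePair f.B g.1).1 + g.2.1 • f.e₂ + s • f.e₁, (planePair f.B g.1).2 + g.2.2 • f.e₁ + t • f.e₂]

/-- As a function of `s` and `t` the value is bilinear up to terms of lower degree, with `φ ![e₁,
e₂]` as the coefficient of `s * t`; the mixed difference isolates it. -/
theorem map_gridPoint_sub (φ : V [⋀^Fin 2]→ₗ[F] F) (g : Submodule F V × F × F) (s s' t t' : F) :
    φ (f.gridPoint g s t) - φ (f.gridPoint g s' t) - (φ (f.gridPoint g s t') -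
      φ (f.gridPoint g s' t')) = (s - s') * (t - t') * φ ![f.e₁, f.e₂] := by
  simp only [gridPoint, map_pair_add_right, map_pair_smul_right, map_pair_add_left,
    map_pair_smul_left, map_pair_self, map_pair_swap φ f.e₁ f.e₂]
  ring

theorem grids_spec {g : Submodule F V × F × F} (hg : g ∈ f.grids) :
    finrank F g.1 = 2 ∧ g.1 ≤ f.K ∧ (planePair f.B g.1).1 ∈ f.B ∧
      LinearIndependent F ![(planePair f.B g.1).1, (planePair f.B g.1).2] ∧
      span F {(planePair f.B g.1).1, (planePair f.B g.1).2} = g.1 := by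
  have h2 : finrank F g.1 = 2 := by
    rcases hg with ⟨h, -⟩ | h
    exacts [h.2.1, h.2]
  refine ⟨h2, ?_, planePair_spec h2 ?_⟩
  · rcases hg with ⟨h, -⟩ | h
    exacts [h.1, h.1.trans f.B_le_K]
  · intro hbot
    rcases hg with ⟨h, -⟩ | h
    · have := h.2.2
      rw [hbot, finrank_bot] at this
      omega
    · rw [inf_eq_left.2 h.1] at hbot
      rw [hbot, finrank_bot] at h2
      omega

theorem proj_planePair {g : Submodule F V × F × F} (hg : g ∈ f.grids) :
    f.proj (planePair f.B g.1).1 = (planePair f.B g.1).1 ∧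
      f.proj (planePair f.B g.1).2 = (planePair f.B g.1).2 := by
  obtain ⟨-, hK, -, -, hs⟩ := f.grids_spec hg
  have h1 : (planePair f.B g.1).1 ∈ f.K := hK (hs.le (subset_span (by simp)))
  have h2 : (planePair f.B g.1).2 ∈ f.K := hK (hs.le (subset_span (by simp)))
  exact ⟨f.proj_of_mem _ h1, f.proj_of_mem _ h2⟩

theorem map_gridPoint {g : Submodule F V × F × F} (hg : g ∈ f.grids) (s t : F) :
    (span F (Set.range (f.gridPoint g s t))).map f.proj = g.1 := by
  obtain ⟨h1, h2⟩ := f.proj_planePair hg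
  rw [gridPoint, map_span_range_pair]
  simp only [map_add, map_smul, f.proj_e₁, f.proj_e₂, smul_zero, add_zero, h1, h2]
  exact (f.grids_spec hg).2.2.2.2

theorem linearIndependent_gridPoint {g : Submodule F V × F × F} (hg : g ∈ f.grids) (s t : F) :
    LinearIndependent F (f.gridPoint g s t) := by
  obtain ⟨h1, h2⟩ := f.proj_planePair hg
  refine LinearIndependent.of_comp f.proj ?_
  convert (f.grids_spec hg).2.2.2.1 using 1
  ext i
  fin_cases i <;> simp [gridPoint, f.proj_e₁, f.proj_e₂, h1, h2]

/-- Projection along `P` forces the coefficients 1 and 0, by independence of `x` and `y`. So the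
`P`-parts of the generators can be read off from the span. -/
theorem eq_of_gridPoint_mem {x y d d' e' : V} (hxy : LinearIndependent F ![x, y])
    (hx : f.proj x = x) (hy : f.proj y = y) (hd : f.proj d = 0) (hd' : f.proj d' = 0)
    (he' : f.proj e' = 0) (h : x + d ∈ span F {x + d', y + e'}) : d = d' := by
  obtain ⟨r, s, hrs⟩ := mem_span_pair.1 h
  have h1 := congrArg f.proj hrs
  simp only [map_add, map_smul, hx, hy, hd, hd', he', add_zero] at h1
  have h2 := LinearIndependent.pair_iff.1 hxy (r - 1) s (by
    rw [sub_smul, one_smul, sub_add_eq_add_sub, h1, sub_self])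
  obtain ⟨hr, rfl⟩ := h2
  rw [sub_eq_zero.1 hr, one_smul, zero_smul, add_zero] at hrs
  exact (add_left_cancel hrs).symm

theorem gridPoint_injective {g g' : Submodule F V × F × F} (hg : g ∈ f.grids)
    (hg' : g' ∈ f.grids) {s t s' t' : F}
    (h : span F (Set.range (f.gridPoint g s t)) = span F (Set.range (f.gridPoint g' s' t'))) :
    g = g' ∧ s = s' ∧ t = t' := by
  obtain ⟨T, n₁, n₂⟩ := g
  obtain ⟨T', n₁', n₂'⟩ := g'
  obtain rfl : T = T' := by
    rw [← show _ = T from f.map_gridPoint hg s t, h, f.map_gridPoint hg']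
  obtain ⟨h1, h2⟩ := f.proj_planePair hg
  have hli := (f.grids_spec hg).2.2.2.1
  simp only [gridPoint, add_assoc, span_range_pair] at h h1 h2 hli
  have k₁ : n₁ • f.e₂ + s • f.e₁ = n₁' • f.e₂ + s' • f.e₁ := by
    refine f.eq_of_gridPoint_mem hli h1 h2 ?_ ?_ ?_ (h ▸ subset_span (Set.mem_insert _ _)) <;>
      simp [f.proj_e₁, f.proj_e₂]
  have k₂ : n₂ • f.e₁ + t • f.e₂ = n₂' • f.e₁ + t' • f.e₂ := by
    rw [Set.pair_comm, Set.pair_comm (_ + (n₁' • _ + _))] at h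
    refine f.eq_of_gridPoint_mem (LinearIndependent.pair_symm_iff.1 hli) h2 h1 ?_ ?_ ?_
      (h ▸ subset_span (Set.mem_insert _ _)) <;> simp [f.proj_e₁, f.proj_e₂]
  have a₁ := congrArg f.c₁ k₁
  have a₂ := congrArg f.c₂ k₁
  have b₁ := congrArg f.c₁ k₂
  have b₂ := congrArg f.c₂ k₂
  simp only [map_add, map_smul, f.c₁_e₁, f.c₁_e₂, f.c₂_e₁, f.c₂_e₂, smul_eq_mul, mul_zero, mul_one,
    add_zero, zero_add] at a₁ a₂ b₁ b₂
  subst a₁ a₂ b₁ b₂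
  exact ⟨rfl, rfl, rfl⟩

theorem exists_gridPoint_mem {g : Submodule F V × F × F} (hg : g ∈ f.grids) (s t : F) :
    ∃ z ∈ span F {f.gridPoint g s t 0, f.gridPoint g s t 1}, z ∈ A ∧ z ≠ 0 := by
  have hli := f.linearIndependent_gridPoint hg s t
  obtain ⟨-, -, hB, -, hsp⟩ := f.grids_spec hg
  have hA1 : (planePair f.B g.1).1 ∈ A := f.B_le_A hB
  by_cases hn : g.2.1 • f.e₂ ∈ A
  · refine ⟨_, subset_span (Set.mem_insert _ _), ?_, hli.ne_zero 0⟩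
    exact A.add_mem (A.add_mem hA1 hn) (A.smul_mem _ f.e₁_mem)
  · have hT : g.1 ≤ f.B := by
      rcases hg with h | h
      exacts [(hn h.2).elim, h.1]
    have hA2 : (planePair f.B g.1).2 ∈ A :=
      f.B_le_A (hT (hsp.le (subset_span (by simp))))
    -- This combination eliminates `e₂`; what is left lies in `B` plus multiples of `e₁`. It is
    -- non-zero because `g.2.1 = 0` would put `g.2.1 • f.e₂` in `A`.
    refine ⟨t • f.gridPoint g s t 0 + (-g.2.1) • f.gridPoint g s t 1,
      mem_span_pair.2 ⟨_, _, rfl⟩, ?_, ?_⟩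
    · have : t • f.gridPoint g s t 0 + (-g.2.1) • f.gridPoint g s t 1 =
          t • (planePair f.B g.1).1 + (-g.2.1) • (planePair f.B g.1).2 +
            (t * s - g.2.1 * g.2.2) • f.e₁ := by
        simp only [gridPoint, Matrix.cons_val_zero, Matrix.cons_val_one]
        module
      rw [this]
      exact A.add_mem (A.add_mem (A.smul_mem _ hA1) (A.smul_mem _ hA2)) (A.smul_mem _ f.e₁_mem)
    · intro h0
      have hli' : LinearIndependent F ![f.gridPoint g s t 0, f.gridPoint g s t 1] := by
        convert hli using 1
        ext i
        fin_cases i <;> rfl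
      have := (LinearIndependent.pair_iff.1 hli' _ _ h0).2
      apply hn
      rw [neg_eq_zero.1 this, zero_smul]
      exact A.zero_mem

end PlaneFrame

end PlaneFrames

/-! ### The orthogonal checks from lines and grids. -/

section OrthogonalChecks

open Module Submodule

variable {F V : Type*} [Field F] [DecidableEq F] [AddCommGroup V] [Module F V]
  [Finite V] {m : ℕ}

theorem Fintype.sum_filter_fst_eq {I κ M : Type*} [Fintype I] [Fintype κ] [DecidableEq I]
    [AddCommMonoid M] (g : I × κ → M) (i : I) :
    ∑ e : I × κ with e.1 = i, g e = ∑ k, g (i, k) := by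
  rw [Finset.sum_filter, Fintype.sum_prod_type, Finset.sum_eq_single i]
  · simp
  · intro j _ hj
    simp [hj]
  · simp

/-- `1` and `-1`. -/
def boolSign (F : Type*) [Field F] (c : Bool) : F := bif c then 1 else -1

theorem boolSign_ne_zero {F : Type*} [Field F] (c : Bool) : boolSign F c ≠ 0 := by
  cases c <;> simp [boolSign]

theorem embedding_sub_ne_zero {F : Type*} [Field F] {h : ℕ} (s : Fin h × Bool ↪ F)
    (i : Fin h) : s (i, true) - s (i, false) ≠ 0 := by
  rw [sub_ne_zero]
  exact fun h => by simpa using s.injective h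

namespace PlaneFrame

variable (b : Basis (Fin m) F V) (u : ∀ P : grassmannian F V 2, Basis (Fin 2) F P.1)
  {A : Fin 2 → Submodule F V} {P : schubertVariety A} (f : PlaneFrame (A 0) P.1) {h : ℕ}

/-- The embedding `s` selects `h` disjoint pairs of scalars. Each pair on each line gives a check
through two of its points and `P`. The rank of the projection is recorded to separate these supports
from those of the grids. -/
theorem exists_line_checks [Finite F] (hA : A 1 = ⊤) (s : Fin h × Bool ↪ F) :
    ∃ 𝒥 : Finset (schubertVariety A → F), 𝒥.card = f.lines.ncard * h ∧
      IsOrthogonalOn (schubertCode b u A) 𝒥 P ∧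
      (∀ w ∈ 𝒥, ∃ Q, Q ≠ P ∧ w Q ≠ 0) ∧
      ∀ w ∈ 𝒥, ∀ Q, Q ≠ P → w Q ≠ 0 → finrank F (Q.1.map f.proj) = 1 := by
  classical
  have := Fintype.ofFinite f.lines
  have hmap : ∀ x : f.lines, ∀ t, (span F (Set.range (f.linePoint x.1 t))).map f.proj = x.1.2 :=
    fun x t => f.map_linePoint x.2 t
  obtain ⟨𝒥, h₁, h₂, h₃, h₄⟩ := exists_isOrthogonalOn_of_relations b u A P f.span_eq
    (E := (f.lines × Fin h) × Bool) (I := f.lines × Fin h) (π := Prod.fst)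
    (fun i => ⟨(i, true), rfl⟩)
    (r := fun e => f.sign e.1.1.1.1 * (s (e.1.2, true) - s (e.1.2, false))⁻¹ * boolSign F e.2)
    (fun e => mul_ne_zero (mul_ne_zero (f.sign_ne_zero _)
      (inv_ne_zero (embedding_sub_ne_zero s _))) (boolSign_ne_zero _))
    (v := fun e => f.linePoint e.1.1.1 (s (e.1.2, e.2)))
    (fun e => by
      obtain ⟨z, hz, hzA, hz0⟩ := f.exists_linePoint_mem e.1.1.2 (s (e.1.2, e.2))
      exact span_pair_mem_schubertVariety hA (f.linearIndependent_linePoint e.1.1.2 _) hz hzA hz0)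
    (fun e he => by
      have h1 := hmap e.1.1 (s (e.1.2, e.2))
      rw [he, f.map_proj_plane] at h1
      have h2 := e.1.1.2.1.2
      rw [← h1, finrank_bot] at h2
      omega)
    (by
      rintro ⟨⟨x, i⟩, c⟩ ⟨⟨x', i'⟩, c'⟩ he
      obtain ⟨hx, ht⟩ := f.linePoint_injective x.2 x'.2 he
      obtain rfl := Subtype.ext hx
      obtain ⟨rfl, rfl⟩ := Prod.mk.inj (s.injective ht)
      rfl)
    (by
      rintro φ ⟨x, i⟩
      rw [Fintype.sum_filter_fst_eq, Fintype.sum_bool]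
      have h1 := f.map_linePoint_sub φ x.1 (s (i, true)) (s (i, false))
      have h2 := embedding_sub_ne_zero s i
      have h3 := f.sign_mul_self x.1.1
      simp only [boolSign, cond_true, cond_false]
      rw [show ∀ c d y z : F, c * d * 1 * y + c * d * (-1) * z = c * (d * (y - z)) by
        intros; ring, h1, inv_mul_cancel_left₀ h2, ← mul_assoc, h3, one_mul])
  refine ⟨𝒥, ?_, h₂, h₃, fun w hw Q hQ hne => ?_⟩
  · rw [h₁, Fintype.card_prod, Fintype.card_fin, ← Nat.card_eq_fintype_card]
    rfl
  · obtain ⟨e, he⟩ := h₄ w hw Q hQ hne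
    rw [← he, hmap]
    exact e.1.1.2.1.2

/-- One pair for each grid parameter selects the four corners of a rectangle; distinct choices of
pairs have disjoint corners. -/
theorem exists_grid_checks [Finite F] (hA : A 1 = ⊤) (s : Fin h × Bool ↪ F) :
    ∃ 𝒥 : Finset (schubertVariety A → F), 𝒥.card = f.grids.ncard * h ^ 2 ∧
      IsOrthogonalOn (schubertCode b u A) 𝒥 P ∧
      ∀ w ∈ 𝒥, ∀ Q, Q ≠ P → w Q ≠ 0 → finrank F (Q.1.map f.proj) = 2 := by
  classical
  have := Fintype.ofFinite f.grids
  have hmap : ∀ x : f.grids, ∀ t t',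
      (span F (Set.range (f.gridPoint x.1 t t'))).map f.proj = x.1.1 :=
    fun x t t' => f.map_gridPoint x.2 t t'
  obtain ⟨𝒥, h₁, h₂, -, h₄⟩ := exists_isOrthogonalOn_of_relations b u A P f.span_eq
    (E := (f.grids × Fin h × Fin h) × Bool × Bool) (I := f.grids × Fin h × Fin h)
    (π := Prod.fst) (fun i => ⟨(i, (true, true)), rfl⟩)
    (r := fun e => ((s (e.1.2.1, true) - s (e.1.2.1, false)) *
      (s (e.1.2.2, true) - s (e.1.2.2, false)))⁻¹ * (boolSign F e.2.1 * boolSign F e.2.2))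
    (fun e => mul_ne_zero (inv_ne_zero (mul_ne_zero (embedding_sub_ne_zero s _)
      (embedding_sub_ne_zero s _))) (mul_ne_zero (boolSign_ne_zero _) (boolSign_ne_zero _)))
    (v := fun e => f.gridPoint e.1.1.1 (s (e.1.2.1, e.2.1)) (s (e.1.2.2, e.2.2)))
    (fun e => by
      obtain ⟨z, hz, hzA, hz0⟩ :=
        f.exists_gridPoint_mem e.1.1.2 (s (e.1.2.1, e.2.1)) (s (e.1.2.2, e.2.2))
      exact span_pair_mem_schubertVariety hA (f.linearIndependent_gridPoint e.1.1.2 _ _) hz hzA hz0)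
    (fun e he => by
      have h1 := hmap e.1.1 (s (e.1.2.1, e.2.1)) (s (e.1.2.2, e.2.2))
      rw [he, f.map_proj_plane] at h1
      have h2 := (f.grids_spec e.1.1.2).1
      rw [← h1, finrank_bot] at h2
      omega)
    (by
      rintro ⟨⟨x, i, j⟩, c, d⟩ ⟨⟨x', i', j'⟩, c', d'⟩ he
      obtain ⟨hx, ht, ht'⟩ := f.gridPoint_injective x.2 x'.2 he
      obtain rfl := Subtype.ext hx
      obtain ⟨rfl, rfl⟩ := Prod.mk.inj (s.injective ht)
      obtain ⟨rfl, rfl⟩ := Prod.mk.inj (s.injective ht')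
      rfl)
    (by
      rintro φ ⟨x, i, j⟩
      rw [Fintype.sum_filter_fst_eq, Fintype.sum_prod_type, Fintype.sum_bool, Fintype.sum_bool,
        Fintype.sum_bool]
      have h1 := f.map_gridPoint_sub φ x.1 (s (i, true)) (s (i, false)) (s (j, true))
        (s (j, false))
      have h2 := mul_ne_zero (embedding_sub_ne_zero s i) (embedding_sub_ne_zero s j)
      simp only [boolSign, cond_true, cond_false]
      rw [← inv_mul_cancel_left₀ h2 (φ ![f.e₁, f.e₂]), ← h1]
      ring)
  refine ⟨𝒥, ?_, h₂, fun w hw Q hQ hne => ?_⟩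
  · rw [h₁, Fintype.card_prod, Fintype.card_prod, Fintype.card_fin, ← Nat.card_eq_fintype_card,
      sq]
    rfl
  · obtain ⟨e, he⟩ := h₄ w hw Q hQ hne
    rw [← he, hmap]
    exact (f.grids_spec e.1.1.2).1

theorem exists_checks [Finite F] (hA : A 1 = ⊤) (s : Fin h × Bool ↪ F) :
    ∃ 𝒥 : Finset (schubertVariety A → F), 𝒥.card = f.lines.ncard * h + f.grids.ncard * h ^ 2 ∧
      IsOrthogonalOn (schubertCode b u A) 𝒥 P := by
  obtain ⟨𝒥₁, h₁, ho₁, hne, hs₁⟩ := f.exists_line_checks b u hA s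
  obtain ⟨𝒥₂, h₂, ho₂, hs₂⟩ := f.exists_grid_checks b u hA s
  obtain ⟨𝒥, h𝒥, ho⟩ := ho₁.exists_union ho₂ hne fun w₁ hw₁ w₂ hw₂ Q hQ hn₁ hn₂ => by
    have k₁ := hs₁ w₁ hw₁ Q hQ hn₁
    have k₂ := hs₂ w₂ hw₂ Q hQ hn₂
    omega
  exact ⟨𝒥, by rw [h𝒥, h₁, h₂], ho⟩

end PlaneFrame

end OrthogonalChecks

/-! ### Comparing the number of checks with J. -/

section CheckNumbers

open Module Submodule

theorem gaussBinom_one (q n : ℕ) : gaussBinom q n 1 = ((q : ℚ) ^ n - 1) / ((q : ℚ) - 1) := by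
  simp [gaussBinom]

theorem PlaneFrame.ncard_lines_of_le {F V : Type*} [Field F] [Fintype F] [AddCommGroup V]
    [Module F V] {A P : Submodule F V} (f : PlaneFrame A P) (h : P ≤ A) :
    f.lines.ncard = (1 + Fintype.card F) * (subspaceLines f.K).ncard := by
  have : f.lines = Set.univ ×ˢ subspaceLines f.K := by
    ext x
    simp [lines, h]
  rw [this, Set.ncard_prod, Set.ncard_univ, Nat.card_eq_fintype_card, Fintype.card_option, add_comm]

variable {F V : Type*} [Field F] [Fintype F] [AddCommGroup V] [Module F V] [Finite V]

theorem one_lt_card_cast (F : Type*) [Field F] [Fintype F] : (1 : ℚ) < Fintype.card F := by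
  exact_mod_cast Fintype.one_lt_card

theorem cast_ncard_subspaceLines (W : Submodule F V) :
    ((subspaceLines W).ncard : ℚ) =
      ((Fintype.card F : ℚ) ^ finrank F W - 1) / (Fintype.card F - 1) := by
  have h := congrArg (Nat.cast : ℕ → ℚ) (ncard_subspaceLines_mul W)
  have hq := one_lt_card_cast F
  have h1 : 1 ≤ Fintype.card F := Fintype.card_pos
  rw [Nat.cast_mul, Nat.cast_sub h1, Nat.cast_sub (Nat.one_le_pow _ _ h1)] at h
  rw [eq_div_iff (by linarith)]
  exact_mod_cast h

theorem cast_ncard_secantPlanes {B W : Submodule F V} (hB : B ≤ W) :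
    ((secantPlanes B W).ncard : ℚ) =
      ((Fintype.card F : ℚ) ^ finrank F B - 1) *
        ((Fintype.card F : ℚ) ^ finrank F W - (Fintype.card F : ℚ) ^ finrank F B) /
          ((Fintype.card F - 1) * ((Fintype.card F : ℚ) ^ 2 - Fintype.card F)) := by
  have h := congrArg (Nat.cast : ℕ → ℚ) (ncard_secantPlanes_mul hB)
  have hq := one_lt_card_cast F
  have h1 : 1 ≤ Fintype.card F := Fintype.card_pos
  have h2 := Nat.pow_le_pow_right h1 (finrank_mono hB)
  rw [Nat.cast_mul, Nat.cast_mul, Nat.cast_mul, Nat.cast_sub h1,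
    Nat.cast_sub (Nat.one_le_pow _ _ h1), Nat.cast_sub h2,
    Nat.cast_sub (Nat.le_self_pow two_ne_zero _)] at h
  rw [eq_div_iff (mul_ne_zero (by linarith) (by nlinarith))]
  exact_mod_cast h

theorem cast_ncard_subspacePlanes (W : Submodule F V) :
    ((subspacePlanes W).ncard : ℚ) =
      ((Fintype.card F : ℚ) ^ finrank F W - 1) *
        ((Fintype.card F : ℚ) ^ finrank F W - Fintype.card F) /
          (((Fintype.card F : ℚ) ^ 2 - 1) * ((Fintype.card F : ℚ) ^ 2 - Fintype.card F)) := by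
  have hq := one_lt_card_cast F
  have h1 : 1 ≤ Fintype.card F := Fintype.card_pos
  have hne : ((Fintype.card F : ℚ) ^ 2 - 1) * ((Fintype.card F : ℚ) ^ 2 - Fintype.card F) ≠ 0 :=
    mul_ne_zero (by nlinarith) (by nlinarith)
  have h := congrArg (Nat.cast : ℕ → ℚ) (ncard_subspacePlanes_mul W)
  rw [eq_div_iff hne]
  -- In rank 0 the natural subtraction `q ^ 0 - q` truncates and does not commute with the cast;
  -- there both sides vanish.
  rcases Nat.eq_zero_or_pos (finrank F W) with h0 | h0
  · simp only [h0, pow_zero, sub_self, Nat.sub_self, zero_mul, Nat.cast_zero] at h ⊢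
    rcases Nat.mul_eq_zero.1 (Nat.cast_eq_zero.1 h) with h | h
    · rw [h, Nat.cast_zero, zero_mul]
    · rw [Nat.mul_eq_zero] at h
      have : Fintype.card F < Fintype.card F ^ 2 := by
        have : 1 < Fintype.card F := Fintype.one_lt_card
        nlinarith
      omega
  · rw [Nat.cast_mul, Nat.cast_mul, Nat.cast_mul, Nat.cast_sub (Nat.one_le_pow _ _ h1),
      Nat.cast_sub (Nat.one_le_pow _ _ h1), Nat.cast_sub (Nat.le_self_pow two_ne_zero _),
      Nat.cast_sub (Nat.le_self_pow h0.ne' _)] at h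
    exact_mod_cast h

/-- The number of checks built from a subspace `B` of `K` is the number `J`. -/
theorem schubertJ_eq {m a : ℕ} {B K : Submodule F V} (hBK : B ≤ K) (hB : finrank F B + 1 = a)
    (hK : finrank F K + 2 = m) :
    schubertJ (Fintype.card F) m a =
      (((subspaceLines K).ncard + Fintype.card F * (subspaceLines B).ncard) * (Fintype.card F / 2) +
        ((secantPlanes B K).ncard * Fintype.card F +
          (subspacePlanes B).ncard * Fintype.card F ^ 2) * (Fintype.card F / 2) ^ 2 : ℕ) := by
  have hq := one_lt_card_cast F
  have e₁ : m - 2 = finrank F K := by omega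
  have e₂ : a - 1 = finrank F B := by omega
  have e₃ : 2 * a - 2 = finrank F B * 2 := by omega
  push_cast
  rw [schubertJ, gaussBinom_one, gaussBinom_one, cast_ncard_subspaceLines,
    cast_ncard_subspaceLines, cast_ncard_secantPlanes hBK, cast_ncard_subspacePlanes, e₁, e₂, e₃,
    pow_mul]
  -- The equality is a rational function identity in the two powers, `q` and `h`; that `h` is the
  -- integer part of `q / 2` plays no role.
  generalize (Fintype.card F : ℚ) ^ finrank F K = X
  generalize (Fintype.card F : ℚ) ^ finrank F B = C
  generalize ((Fintype.card F / 2 : ℕ) : ℚ) = h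
  generalize (Fintype.card F : ℚ) = q at hq ⊢
  have h1 : q - 1 ≠ 0 := by linarith
  have h2 : q + 1 ≠ 0 := by linarith
  have h3 : q ≠ 0 := by linarith
  have h4 : q ^ 2 - 1 = (q - 1) * (q + 1) := by ring
  have h5 : q ^ 2 - q = q * (q - 1) := by ring
  rw [h4, h5]
  field_simp
  ring

/-- This is the case `P ≤ A`, where `B` has dimension `a - 2`. With `h` the integer part of `q / 2`,
the surplus over J is `h (q - h) (q ^ (m - 2) - q ^ (a - 1)) / (q - 1)`, which is non-negative since
`a < m`. -/
theorem schubertJ_le {m a : ℕ} {B K : Submodule F V} (hBK : B ≤ K) (hB : finrank F B + 2 = a)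
    (hK : finrank F K + 2 = m) (ham : a < m) :
    schubertJ (Fintype.card F) m a ≤
      ((1 + Fintype.card F) * (subspaceLines K).ncard * (Fintype.card F / 2) +
        ((secantPlanes B K).ncard * Fintype.card F ^ 2 +
          (subspacePlanes B).ncard * Fintype.card F ^ 2) * (Fintype.card F / 2) ^ 2 : ℕ) := by
  have hq := one_lt_card_cast F
  have e₁ : m - 2 = finrank F K := by omega
  have e₂ : a - 1 = finrank F B + 1 := by omega
  have e₃ : 2 * a - 2 = (finrank F B + 1) * 2 := by omega
  have hX : (Fintype.card F : ℚ) ^ (finrank F B + 1) ≤ (Fintype.card F : ℚ) ^ finrank F K :=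
    pow_le_pow_right₀ hq.le (by omega)
  have hh : ((Fintype.card F / 2 : ℕ) : ℚ) ≤ Fintype.card F := by
    exact_mod_cast Nat.div_le_self _ _
  have hh0 : (0 : ℚ) ≤ ((Fintype.card F / 2 : ℕ) : ℚ) := Nat.cast_nonneg _
  push_cast
  rw [schubertJ, gaussBinom_one, gaussBinom_one, cast_ncard_subspaceLines,
    cast_ncard_secantPlanes hBK, cast_ncard_subspacePlanes, e₁, e₂, e₃,
    pow_mul]
  rw [pow_succ _ (finrank F B)] at hX ⊢
  generalize (Fintype.card F : ℚ) ^ finrank F K = X at *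
  generalize (Fintype.card F : ℚ) ^ finrank F B = C at *
  generalize ((Fintype.card F / 2 : ℕ) : ℚ) = h at *
  generalize (Fintype.card F : ℚ) = q at *
  have h1 : q - 1 ≠ 0 := by linarith
  have h2 : q + 1 ≠ 0 := by linarith
  have h3 : q ≠ 0 := by linarith
  have h4 : q ^ 2 - 1 = (q - 1) * (q + 1) := by ring
  have h5 : q ^ 2 - q = q * (q - 1) := by ring
  rw [h4, h5, ← sub_nonneg]
  have key : 0 ≤ h * (q - h) * (X - C * q) / (q - 1) :=
    div_nonneg (mul_nonneg (mul_nonneg hh0 (by linarith)) (by linarith)) (by linarith)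
  refine key.trans_eq ?_
  field_simp
  ring

namespace PlaneFrame

variable {A P : Submodule F V} (f : PlaneFrame A P)

theorem ncard_grids : f.grids.ncard =
    (secantPlanes f.B f.K).ncard * ({ν : F | ν • f.e₂ ∈ A}.ncard * Fintype.card F) +
      (subspacePlanes f.B).ncard * Fintype.card F ^ 2 := by
  rw [grids_eq, Set.ncard_union_eq]
  · simp only [Set.ncard_prod, Set.ncard_univ, Nat.card_eq_fintype_card]
    rw [sq]
  · rw [Set.disjoint_left]
    rintro ⟨T, ν⟩ ⟨hT, -⟩ ⟨hT', -⟩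
    have h1 : finrank F ↥(T ⊓ f.B) = 1 := hT.2.2
    have h2 : finrank F T = 2 := hT.2.1
    have h3 : T ⊓ f.B = T := inf_eq_left.2 hT'.1
    rw [h3] at h1
    omega

theorem ncard_grids_of_le (h : P ≤ A) : f.grids.ncard =
    (secantPlanes f.B f.K).ncard * Fintype.card F ^ 2 +
      (subspacePlanes f.B).ncard * Fintype.card F ^ 2 := by
  have : {ν : F | ν • f.e₂ ∈ A} = Set.univ :=
    Set.eq_univ_of_forall fun ν => f.smul_e₂_mem_iff.2 (.inr h)
  rw [ncard_grids, this, Set.ncard_univ, Nat.card_eq_fintype_card, sq]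

theorem ncard_lines_of_not_le (h : ¬P ≤ A) : f.lines.ncard =
    (subspaceLines f.K).ncard + Fintype.card F * (subspaceLines f.B).ncard := by
  have : f.lines = {none} ×ˢ subspaceLines f.K ∪ Set.range some ×ˢ subspaceLines f.B := by
    ext ⟨U, S⟩
    have hBK := f.B_le_K
    cases U
    · simp [lines]
    · simp only [lines, subspaceLines, Set.mem_ofPred_eq, h, or_false, reduceCtorEq, false_or,
        Set.mem_union, Set.mem_prod, Set.mem_singleton_iff, false_and, Set.mem_range_self, true_and]
      constructor
      · rintro ⟨⟨-, h1⟩, h2⟩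
        exact ⟨h2, h1⟩
      · rintro ⟨h2, h1⟩
        exact ⟨⟨h2.trans hBK, h1⟩, h2⟩
  rw [this, Set.ncard_union_eq, Set.ncard_prod, Set.ncard_prod, Set.ncard_singleton, one_mul,
    ← Set.image_univ, Set.ncard_image_of_injective _ (Option.some_injective F), Set.ncard_univ,
    Nat.card_eq_fintype_card]
  rw [Set.disjoint_left]
  rintro ⟨U, S⟩ ⟨rfl, -⟩ ⟨⟨s, hs⟩, -⟩
  cases hs

theorem ncard_grids_of_not_le (h : ¬P ≤ A) : f.grids.ncard =
    (secantPlanes f.B f.K).ncard * Fintype.card F +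
      (subspacePlanes f.B).ncard * Fintype.card F ^ 2 := by
  have : {ν : F | ν • f.e₂ ∈ A} = {0} := by
    ext ν
    rw [Set.mem_ofPred_eq, f.smul_e₂_mem_iff]
    simp [h]
  rw [ncard_grids, this, Set.ncard_singleton, one_mul]

end PlaneFrame

/-- The number `J` is an integer. -/
theorem exists_natCast_eq_schubertJ {m a : ℕ} (b : Basis (Fin m) F V) (ha : 2 ≤ a)
    (ham : a ≤ m - 1) : ∃ J : ℕ, (J : ℚ) = schubertJ (Fintype.card F) m a := by
  -- Nested coordinate subspaces of dimensions `a - 1` and `m - 2` realise J as a count, whether or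
  -- not some plane gives a frame with these dimensions.
  have hspan : ∀ k (hk : k ≤ m), finrank F (span F (Set.range (b ∘ Fin.castLE hk))) = k := by
    intro k hk
    rw [_root_.finrank_span_eq_card
      (b.linearIndependent.comp _ (Fin.castLE_injective hk)), Fintype.card_fin]
  have hle : span F (Set.range (b ∘ Fin.castLE (show a - 1 ≤ m by omega))) ≤
      span F (Set.range (b ∘ Fin.castLE (show m - 2 ≤ m by omega))) := by
    refine span_mono ?_
    rintro _ ⟨i, rfl⟩
    exact ⟨Fin.castLE (by omega) i, rfl⟩
  exact ⟨_, (schubertJ_eq hle (by rw [hspan]; omega) (by rw [hspan]; omega)).symm⟩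

theorem exists_isOrthogonalOn_card_eq_schubertJ [DecidableEq F] {m a : ℕ} (ha : 2 ≤ a)
    (ham : a ≤ m - 1) (b : Basis (Fin m) F V)
    (u : ∀ P : grassmannian F V 2, Basis (Fin 2) F P.1) (A : Fin 2 → Submodule F V)
    (hA : IsPartialFlag A ![a, m]) (P : schubertVariety A) :
    ∃ 𝒥 : Finset (schubertVariety A → F), (𝒥.card : ℚ) = schubertJ (Fintype.card F) m a ∧
      IsOrthogonalOn (schubertCode b u A) 𝒥 P := by
  have hV : finrank F V = m := by rw [finrank_eq_card_basis b, Fintype.card_fin]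
  have hA0 : finrank F (A 0) = a := hA.2 0
  have hA1 : A 1 = ⊤ := eq_top_of_finrank_eq ((hA.2 1).trans hV.symm)
  have hP : finrank F P.1 = 2 := P.2.1
  have hPA : 1 ≤ finrank F ↥(P.1 ⊓ A 0) := P.2.2 0
  obtain ⟨f, hK, hB⟩ := PlaneFrame.exists_of_finrank hP (one_le_finrank_iff.1 hPA)
  rw [hV] at hK
  rw [hA0] at hB
  -- The field contains `q / 2` disjoint pairs of scalars; for odd `q` one scalar is left unused.
  obtain ⟨s⟩ : Nonempty (Fin (Fintype.card F / 2) × Bool ↪ F) := by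
    refine Function.Embedding.nonempty_of_card_le ?_
    rw [Fintype.card_prod, Fintype.card_fin, Fintype.card_bool]
    omega
  obtain ⟨𝒥, h𝒥, ho⟩ := f.exists_checks b u hA1 s
  obtain ⟨J, hJ⟩ := exists_natCast_eq_schubertJ b ha ham
  have hle : J ≤ 𝒥.card := by
    rw [h𝒥]
    by_cases hle : P.1 ≤ A 0
    · rw [f.ncard_lines_of_le hle, f.ncard_grids_of_le hle]
      rw [inf_eq_left.2 hle, hP] at hB
      have := schubertJ_le f.B_le_K hB hK (by omega)
      rw [← hJ] at this
      exact_mod_cast this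
    · have hlt := finrank_lt_finrank_of_lt (inf_lt_left.2 hle)
      have h1 : finrank F ↥(P.1 ⊓ A 0) = 1 := by omega
      rw [h1] at hB
      rw [f.ncard_lines_of_not_le hle, f.ncard_grids_of_not_le hle]
      have := schubertJ_eq f.B_le_K hB hK
      rw [← hJ] at this
      exact (Nat.cast_injective this).le
  -- Surplus checks, which can occur when `P ≤ A 0`, are discarded so that every coordinate has
  -- exactly J.
  obtain ⟨𝒥', hsub, hcard⟩ := Finset.exists_subset_card_eq hle
  exact ⟨𝒥', by rw [hcard, hJ], ho.mono hsub⟩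

end CheckNumbers

theorem theorem5p11 {F V : Type*} [Field F] [Fintype F] [DecidableEq F]
    [AddCommGroup V] [Module F V] [Finite V] (q m a : ℕ) (hq : Fintype.card F = q)
    (ha : 2 ≤ a) (ham : a ≤ m - 1)
    (b : Module.Basis (Fin m) F V)
    (u : ∀ P : grassmannian F V 2, Module.Basis (Fin 2) F P.1)
    (A : Fin 2 → Submodule F V) (hA : IsPartialFlag A ![a, m]) :
    (∀ P : schubertVariety A, ∃ 𝒥 : Finset (schubertVariety A → F),
      (𝒥.card : ℚ) = schubertJ q m a ∧ IsOrthogonalOn (schubertCode b u A) 𝒥 P) ∧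
    (∀ 𝒥 : schubertVariety A → Finset (schubertVariety A → F),
      (∀ P, ((𝒥 P).card : ℚ) = schubertJ q m a ∧
        IsOrthogonalOn (schubertCode b u A) (𝒥 P) P) →
      CorrectsErrors (schubertCode b u A) (majorityLogicDecode 𝒥) ⌊schubertJ q m a / 2⌋₊) := by
  subst hq
  refine ⟨exists_isOrthogonalOn_card_eq_schubertJ ha ham b u A hA, fun 𝒥 h𝒥 => ?_⟩
  obtain ⟨J, hJ⟩ := exists_natCast_eq_schubertJ b ha ham
  have hfloor : ⌊schubertJ (Fintype.card F) m a / 2⌋₊ = J / 2 := by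
    rw [← hJ]
    exact_mod_cast Nat.floor_div_eq_div (K := ℚ) J 2
  rw [hfloor]
  refine correctsErrors_majorityLogicDecode fun P => ⟨?_, (h𝒥 P).2⟩
  exact Nat.cast_injective (R := ℚ) ((h𝒥 P).1.trans hJ.symm)
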